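/- Let $0<L<2\pi$ and $\mathbb T^2=\mathbb R^2/(L\mathbb Z)^2$. For $k=(k_1,k_2)\in\mathbb Z^2$ put $|k|=\max\{|k_1|,|k_2|\}$, $e_k(x)=L^{-1}e^{\mathrm i(2\pi/L)k\cdot x}$ and $\lambda_k=(2\pi/L)^2(k_1^2+k_2^2)-1$. For $N\in\{0,1,2,\dots\}$ let $E_N$ be the real vector space of complex families $y=(y_k)_{|k|\le N}$ with $y_{-k}=\overline{y_k}$ for all $k$, identified with $\mathbb R^{(2N+1)^2}$ as a Euclidean space with $\|y\|^2=\sum_{|k|\le N}|y_k|^2$, and let $\mathrm dy$ be Lebesgue measure on it. Let $\gamma=\gamma_N$ be the Gaussian probability measure on $E_N$ given by $$\mathrm d\gamma(y)=\mathcal N^{-1}e^{-g_N(y)}\,\mathrm dy,\qquad g_N(y)=\frac12\sum_{|k|\le N}|\lambda_k|\,|y_k|^2,\qquad \mathcal N=\int_{E_N}e^{-g_N(y)}\,\mathrm dy .$$ Define the real-valued field $\hat\phi_N(x)=\sum_{|k|\le N}y_ke_k(x)$, the constant $C_N=L^{-2}\sum_{|k|\le N}|\lambda_k|^{-1}$,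 and $$w_N=\frac14\int_{\mathbb T^2}H_4(\hat\phi_N(x),C_N)\,\mathrm dx,\qquad H_4(X,C)=X^4-6CX^2+3C^2 .$$ Here $H_n$ denotes the Hermite polynomials with variance parameter, $H_0=1$, $H_n=XH_{n-1}-C\,\partial_XH_{n-1}$ for $n\ge1$. Then there is a constant $K$, depending on $L$ but not on $N$, such that for every $N$ the random variable $e^{-w_N}$ is $\gamma$-integrable and $$\mathbb E^{\gamma}\bigl[e^{-w_N}\bigr]\le K .$$ -/

import Mathlib

open MeasureTheory

noncomputable section

namespace WickGalerkin

/-- Hermite polynomials `H_n(X, C)` with variance parameter `C`: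
`H_0 = 1` and `H_{n+1} = X * H_n - C * ∂_X H_n`. -/
def hermitePoly (C : ℝ) : ℕ → Polynomial ℝ
  | 0 => 1
  | n + 1 => Polynomial.X * hermitePoly C n
      - Polynomial.C C * Polynomial.derivative (hermitePoly C n)

/-- The value `H_n(X, C)`. -/
def H (n : ℕ) (X C : ℝ) : ℝ := (hermitePoly C n).eval X

theorem H_four (X C : ℝ) : H 4 X C = X ^ 4 - 6 * C * X ^ 2 + 3 * C ^ 2 := by
  simp [H, hermitePoly]
  ring

/-- The two-dimensional torus `ℝ² / (L ℤ)²`. If `L > 0`, its `volume` is Lebesgue measure, of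
total mass `L²`. -/
abbrev Torus (L : ℝ) : Type := AddCircle L × AddCircle L

/-- The wave vectors `k ∈ ℤ²` with `max {|k₁|, |k₂|} ≤ N`. -/
def modes (N : ℕ) : Finset (ℤ × ℤ) :=
  Finset.Icc (-(N : ℤ)) N ×ˢ Finset.Icc (-(N : ℤ)) N

/-- `λ_k = (2π/L)² (k₁² + k₂²) - 1`, the eigenvalue of `-Δ - 1` at wave vector `k`. -/
def eigenval (L : ℝ) (k : ℤ × ℤ) : ℝ :=
  (2 * Real.pi / L) ^ 2 * ((k.1 : ℝ) ^ 2 + (k.2 : ℝ) ^ 2) - 1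

/-- `e_k(x) = L⁻¹ exp(i (2π/L) k · x)`, the `L²`-normalised Fourier basis. -/
def basisFun (L : ℝ) (k : ℤ × ℤ) (x : Torus L) : ℂ :=
  (L : ℂ)⁻¹ * (fourier k.1 x.1 * fourier k.2 x.2)

/-- The renormalisation constant `C_N = L⁻² ∑_{|k| ≤ N} 1 / |λ_k|`. -/
def renormConst (L : ℝ) (N : ℕ) : ℝ :=
  1 / L ^ 2 * ∑ k ∈ modes N, 1 / |eigenval L k|

/-- The real vector space of Fourier coefficients `(y_k)_{|k| ≤ N}` of real fields: complex
families with `y_{-k} = conj y_k`. It is a real inner product space of dimension `(2N+1)²` with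
`‖y‖² = ∑ |y_k|²`. -/
def coeffSpace (N : ℕ) : Submodule ℝ (EuclideanSpace ℂ (modes N)) where
  carrier := {y | ∀ k l : modes N, (l : ℤ × ℤ) = -(k : ℤ × ℤ) → y l = starRingEnd ℂ (y k)}
  add_mem' := by
    intro a b ha hb k l h
    simp [ha k l h, hb k l h]
  zero_mem' := by
    intro k l _
    simp
  smul_mem' := by
    intro c a ha k l h
    simp [ha k l h]

/-- The sum `∑_{|k| ≤ N} y_k e_k(x)`, as a complex number. -/
def fieldC (L : ℝ) {N : ℕ} (y : coeffSpace N) (x : Torus L) : ℂ :=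
  ∑ k : modes N, (y : EuclideanSpace ℂ (modes N)) k * basisFun L k x

theorem neg_mem_modes {N : ℕ} {k : ℤ × ℤ} (hk : k ∈ modes N) : -k ∈ modes N := by
  simp only [modes, Finset.mem_product, Finset.mem_Icc, Prod.fst_neg, Prod.snd_neg] at hk ⊢
  omega

/-- The sum defining the field is real. -/
theorem conj_fieldC (L : ℝ) {N : ℕ} (y : coeffSpace N) (x : Torus L) :
    starRingEnd ℂ (fieldC L y x) = fieldC L y x := by
  unfold fieldC
  rw [map_sum]
  refine Finset.sum_nbij' (fun k => ⟨-k.1, neg_mem_modes k.2⟩)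
    (fun k => ⟨-k.1, neg_mem_modes k.2⟩) (by simp) (by simp) (by simp) (by simp) ?_
  intro k _
  rw [y.2 k ⟨-k.1, neg_mem_modes k.2⟩ rfl]
  simp [basisFun]

/-- The Galerkin-truncated field `φ̂_N(x) = ∑_{|k| ≤ N} y_k e_k(x)`, as a real number. -/
def field (L : ℝ) {N : ℕ} (y : coeffSpace N) (x : Torus L) : ℝ := (fieldC L y x).re

theorem ofReal_field (L : ℝ) {N : ℕ} (y : coeffSpace N) (x : Torus L) :
    (field L y x : ℂ) = fieldC L y x :=
  Complex.conj_eq_iff_re.mp (conj_fieldC L y x)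

/-- The quadratic form `g_N(y) = ½ ∑_{|k| ≤ N} |λ_k| |y_k|²`. -/
def quadForm (L : ℝ) {N : ℕ} (y : coeffSpace N) : ℝ :=
  1 / 2 * ∑ k : modes N, |eigenval L k| * ‖(y : EuclideanSpace ℂ (modes N)) k‖ ^ 2

/-- Lebesgue measure `dy` on the coefficient space, as a Euclidean space of dimension `(2N+1)²`.
The instance is named because the default one on a subtype restricts the measure of the
ambient space, which is not what is meant. -/
def lebesgue (N : ℕ) : Measure (coeffSpace N) :=
  (measureSpaceOfInnerProductSpace (E := coeffSpace N)).volume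

/-- The Gaussian measure `dγ(y) = (∫ e^{-g_N})⁻¹ e^{-g_N(y)} dy`. -/
def gaussianField (L : ℝ) (N : ℕ) : Measure (coeffSpace N) :=
  (lebesgue N).tilted (fun y => -quadForm L y)

theorem eigenval_pos {L : ℝ} (h0 : 0 < L) (hL : L < 2 * Real.pi) {k : ℤ × ℤ} (hk : k ≠ 0) :
    0 < eigenval L k := by
  have h1 : 1 < (2 * Real.pi / L) ^ 2 := by
    have : 1 < 2 * Real.pi / L := by rw [lt_div_iff₀ h0]; linarith
    nlinarith
  have h2 : (1 : ℤ) ≤ k.1 ^ 2 + k.2 ^ 2 := by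
    by_contra! h
    have a := sq_nonneg k.1
    have b := sq_nonneg k.2
    apply hk
    ext
    · exact (pow_eq_zero_iff two_ne_zero).1 (show k.1 ^ 2 = 0 by omega)
    · exact (pow_eq_zero_iff two_ne_zero).1 (show k.2 ^ 2 = 0 by omega)
  have h3 : (1 : ℝ) ≤ (k.1 : ℝ) ^ 2 + (k.2 : ℝ) ^ 2 := by exact_mod_cast h2
  unfold eigenval
  nlinarith

instance (N : ℕ) : (lebesgue N).IsAddHaarMeasure := by
  unfold lebesgue
  infer_instance

theorem norm_sq_coeffSpace {N : ℕ} (y : coeffSpace N) :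
    ‖y‖ ^ 2 = ∑ k, ‖(y : EuclideanSpace ℂ (modes N)) k‖ ^ 2 := by
  change ‖(y : EuclideanSpace ℂ (modes N))‖ ^ 2 = _
  exact EuclideanSpace.norm_sq_eq _

/-- `e^{-g_N}` is integrable, so the measure above is a probability measure. -/
theorem isProbabilityMeasure_gaussianField {L : ℝ} (h0 : 0 < L) (hL : L < 2 * Real.pi) (N : ℕ) :
    IsProbabilityMeasure (gaussianField L N) := by
  have hne : ∀ k, 0 < |eigenval L k| := by
    intro k
    rw [abs_pos]
    by_cases hk : k = 0
    · simp [hk, eigenval]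
    · exact (eigenval_pos h0 hL hk).ne'
  have : NeZero (lebesgue N) := inferInstance
  apply isProbabilityMeasure_tilted
  obtain ⟨c, hc, hc'⟩ : ∃ c > 0, ∀ k : modes N, c ≤ |eigenval L k| := by
    obtain ⟨k, -, hk⟩ := (modes N).exists_min_image (fun k => |eigenval L k|) ⟨0, by simp [modes]⟩
    exact ⟨_, hne k, fun j => hk j j.2⟩
  have hb : 0 < (((c / 2 : ℝ)) : ℂ).re := by simpa using hc
  have key : Integrable (fun y : coeffSpace N => ‖Complex.exp (-((c / 2 : ℝ) : ℂ) * (‖y‖ : ℂ) ^ 2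
      + 0 * ((inner ℝ 0 y : ℝ) : ℂ))‖) (lebesgue N) :=
    (GaussianFourier.integrable_cexp_neg_mul_sq_norm_add (V := coeffSpace N) hb 0 0).norm
  refine key.mono' ?_ ?_
  · apply Continuous.aestronglyMeasurable
    unfold quadForm
    fun_prop
  · filter_upwards with y
    rw [Real.norm_eq_abs, abs_of_pos (Real.exp_pos _), Complex.norm_exp]
    have h1 : (-((c / 2 : ℝ) : ℂ) * (‖y‖ : ℂ) ^ 2 + 0 * ((inner ℝ 0 y : ℝ) : ℂ)).re
        = -(c / 2) * ‖y‖ ^ 2 := by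
      have h2 : (-((c / 2 : ℝ) : ℂ) * (‖y‖ : ℂ) ^ 2 + 0 * ((inner ℝ 0 y : ℝ) : ℂ))
          = ((-(c / 2) * ‖y‖ ^ 2 : ℝ) : ℂ) := by
        push_cast
        ring
      rw [h2, Complex.ofReal_re]
    rw [h1]
    gcongr
    rw [norm_sq_coeffSpace, quadForm]
    have h : c * ∑ k, ‖(y : EuclideanSpace ℂ (modes N)) k‖ ^ 2 ≤
        ∑ k : modes N, |eigenval L k| * ‖(y : EuclideanSpace ℂ (modes N)) k‖ ^ 2 := by
      rw [Finset.mul_sum]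
      gcongr with k _
      exact hc' k
    linarith

/-- `w_N = ¼ ∫ H_4(φ̂_N(x), C_N) dx`, integrated over the torus. -/
def wickQuartic (L : ℝ) [Fact (0 < L)] {N : ℕ} (y : coeffSpace N) : ℝ :=
  1 / 4 * ∫ x : Torus L, H 4 (field L y x) (renormConst L N)

end WickGalerkin

end

/-!
Nelson's argument. In the real coordinates `g_k = |λ_k|^{1/2} (Re y_k + Im y_k)` the measure is a
product of standard Gaussians (`integral_eval_gaussianField`), and the quartics `w_M` of the fields
truncated at `M ≤ N` are polynomials of degree `4` in these coordinates. Two facts compete.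

* `H₄(X, C) ≥ -6 C²`, so `w_M` is bounded below by `-(3/2) L² C_M²`, and `C_M` is at most of order
  `M^{1/64}` (`exists_neg_le_truncQuartic`).
* `w_N - w_M` is small: by Wick's formula `E[H₄(X) H₄(Y)] = 24 E[XY]⁴`
  (`gaussE_hermite_four_mul`) its variance is a sum of `∏ |λ_p|⁻¹` over quadruples of modes with
  zero sum, not all below `M`, and this is `O(M^{-1/4})` uniformly in `N`
  (`exists_gaussE_diffPoly_sq_le`). Hypercontractivity (`gaussE_pow_two_pow_le`) upgrades this to
  moments of high order, with constants that grow polynomially in the order.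

With the cutoffs `M_i = 2^{32 i}` the lower bound reads `w_{M_i} ≥ -D 2^i`, while the moment of
order `2^{i+1}` of `w_N - w_{M_i}` is at most `(B 2^{-i})^{2^i}`. Let `i` be the first index with
`w_N - w_{M_i} ≥ -1`. Then `e^{-w_N} ≤ e^{1 + D 2^i}`, and `|w_N - w_{M_{i-1}}| > 1` if `i > 0`, so
`e^{-w_N}` is at most `e^{1+D} + ∑ e^{1 + D 2^{i+1}} (w_N - w_{M_i})^{2^{i+1}}`. Its expectation is
bounded by a convergent series.

Gaussian expectations of polynomials are treated algebraically, through the linear functional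
`gaussE` given by the moments. Hypercontractivity takes the form `E p⁴ ≤ 9^d (E p²)²` for
polynomials of degree at most `d`. It is proved for random signs, where it is an induction on the
number of variables (`cubeE_walshSum_pow_four_le`), and passes to Gaussians by the central limit
theorem for moments (`tendsto_signE`), as the constant does not depend on the number of signs.
Applying it to `p, p², p⁴, …` gives all moments whose order is a power of two.
-/

noncomputable section

open MeasureTheory

namespace WickGalerkin

/-! ### Polynomials in independent standard Gaussians -/

section GaussianPolynomials

/-- The moments `0 ↦ 1, 1 ↦ 0, n + 2 ↦ (n + 1) * (n-th moment)` of the standard Gaussian. -/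
def gaussMoment : ℕ → ℝ
  | 0 => 1
  | 1 => 0
  | n + 2 => (n + 1) * gaussMoment n

/-- At `n = 0` the truncated subtraction is harmless, since the factor `n` vanishes. -/
theorem gaussMoment_succ (n : ℕ) : gaussMoment (n + 1) = n * gaussMoment (n - 1) := by
  cases n with
  | zero => simp [gaussMoment]
  | succ n => simp [gaussMoment]

variable {ι : Type*} [Fintype ι]

/-- The expectation of a polynomial in independent standard Gaussians indexed by `ι`, as the linear
functional taking a monomial to the product of the moments of its exponents. -/
def gaussE (ι : Type*) [Fintype ι] : MvPolynomial ι ℝ →ₗ[ℝ] ℝ :=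
  (MvPolynomial.basisMonomials ι ℝ).constr ℝ (fun α => ∏ i, gaussMoment (α i))

theorem gaussE_monomial (α : ι →₀ ℕ) (c : ℝ) :
    gaussE ι (MvPolynomial.monomial α c) = c * ∏ i, gaussMoment (α i) := by
  have h : MvPolynomial.monomial α c = c • MvPolynomial.basisMonomials ι ℝ α := by
    simp [MvPolynomial.smul_monomial]
  rw [h, map_smul, gaussE, Module.Basis.constr_basis, smul_eq_mul]

/-- Gaussian integration by parts in one variable. -/
theorem gaussE_X_mul (i : ι) (p : MvPolynomial ι ℝ) :
    gaussE ι (MvPolynomial.X i * p) = gaussE ι (MvPolynomial.pderiv i p) := by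
  classical
  induction p using MvPolynomial.induction_on' with
  | add p q hp hq => simp [mul_add, hp, hq]
  | monomial α c =>
    rw [MvPolynomial.X, MvPolynomial.monomial_mul, MvPolynomial.pderiv_monomial, gaussE_monomial,
      gaussE_monomial, one_mul, mul_assoc,
      ← Finset.mul_prod_erase Finset.univ
        (fun j => gaussMoment ((Finsupp.single i 1 + α : ι →₀ ℕ) j)) (Finset.mem_univ i),
      ← Finset.mul_prod_erase Finset.univ
        (fun j => gaussMoment ((α - Finsupp.single i 1 : ι →₀ ℕ) j)) (Finset.mem_univ i)]
    have h1 : gaussMoment ((Finsupp.single i 1 + α : ι →₀ ℕ) i)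
        = α i * gaussMoment ((α - Finsupp.single i 1 : ι →₀ ℕ) i) := by
      simp [add_comm 1, gaussMoment_succ]
    have h2 : ∀ j ∈ Finset.univ.erase i, gaussMoment ((Finsupp.single i 1 + α : ι →₀ ℕ) j)
        = gaussMoment ((α - Finsupp.single i 1 : ι →₀ ℕ) j) := by
      intro j hj
      simp [(Finset.ne_of_mem_erase hj).symm]
    rw [h1, Finset.prod_congr rfl h2, mul_assoc]

/-- The linear form `∑ i, a i * X i`. -/
def linForm (a : ι → ℝ) : MvPolynomial ι ℝ := ∑ i, MvPolynomial.C (a i) * MvPolynomial.X i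

theorem totalDegree_linForm_le (a : ι → ℝ) : (linForm a).totalDegree ≤ 1 := by
  refine MvPolynomial.totalDegree_finsetSum_le fun i _ => ?_
  refine (MvPolynomial.totalDegree_mul _ _).trans ?_
  simp

/-- The directional derivative `∑ i, a i * ∂/∂X i`. -/
def dirDeriv (a : ι → ℝ) : Derivation ℝ (MvPolynomial ι ℝ) (MvPolynomial ι ℝ) :=
  ∑ i, a i • MvPolynomial.pderiv i

theorem dirDeriv_apply (a : ι → ℝ) (p : MvPolynomial ι ℝ) :
    dirDeriv a p = ∑ i, a i • MvPolynomial.pderiv i p := by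
  have h := congrFun (map_sum Derivation.coeFnAddMonoidHom
    (fun i => a i • MvPolynomial.pderiv (R := ℝ) i) Finset.univ) p
  rw [Finset.sum_apply] at h
  exact h

theorem gaussE_linForm_mul (a : ι → ℝ) (p : MvPolynomial ι ℝ) :
    gaussE ι (linForm a * p) = gaussE ι (dirDeriv a p) := by
  simp only [linForm, dirDeriv_apply, Finset.sum_mul, map_sum, mul_assoc, map_smul]
  refine Finset.sum_congr rfl fun i _ => ?_
  rw [← MvPolynomial.smul_eq_C_mul, map_smul, gaussE_X_mul]

theorem dirDeriv_linForm (a b : ι → ℝ) :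
    dirDeriv a (linForm b) = MvPolynomial.C (∑ i, a i * b i) := by
  classical
  rw [linForm, map_sum, map_sum]
  refine Finset.sum_congr rfl fun j _ => ?_
  rw [dirDeriv_apply, Finset.sum_eq_single j]
  · simp [MvPolynomial.smul_eq_C_mul]
  · intro i _ hi
    simp [MvPolynomial.pderiv_X_of_ne hi.symm]
  · simp

/-- Integrating by parts `n` times: the Hermite polynomial of a Gaussian linear form turns into `n`
derivatives of what it is multiplied by. -/
theorem gaussE_hermite_mul (a b : ι → ℝ) (n : ℕ) (Q : Polynomial ℝ) :
    gaussE ι (Polynomial.aeval (linForm a) (hermitePoly (∑ i, a i * a i) n)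
      * Polynomial.aeval (linForm b) Q)
    = (∑ i, a i * b i) ^ n
      * gaussE ι (Polynomial.aeval (linForm b) (Polynomial.derivative^[n] Q)) := by
  induction n generalizing Q with
  | zero => simp [hermitePoly]
  | succ n ih =>
    have key : gaussE ι (Polynomial.aeval (linForm a) (hermitePoly (∑ i, a i * a i) (n + 1))
        * Polynomial.aeval (linForm b) Q) = (∑ i, a i * b i) *
        gaussE ι (Polynomial.aeval (linForm a) (hermitePoly (∑ i, a i * a i) n)
          * Polynomial.aeval (linForm b) (Polynomial.derivative Q)) := by
      rw [hermitePoly, map_sub, sub_mul, map_sub, map_mul (Polynomial.aeval _),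
        Polynomial.aeval_X, mul_assoc, gaussE_linForm_mul, Derivation.leibniz,
        Derivation.map_aeval, Derivation.map_aeval,
        dirDeriv_linForm, dirDeriv_linForm, ← map_sub]
      have h : ∀ (c : ℝ) (p : MvPolynomial ι ℝ), c * gaussE ι p
          = gaussE ι (MvPolynomial.C c * p) := fun c p => by
        rw [← MvPolynomial.smul_eq_C_mul, map_smul, smul_eq_mul]
      rw [h]
      congr 1
      rw [map_mul, Polynomial.aeval_C, MvPolynomial.algebraMap_eq, smul_eq_mul, smul_eq_mul,
        smul_eq_mul, smul_eq_mul]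
      ring
    rw [key, ih, Function.iterate_succ_apply, pow_succ]
    ring

theorem gaussE_one : gaussE ι 1 = 1 := by
  rw [← MvPolynomial.C_1, MvPolynomial.C_apply, gaussE_monomial]
  simp [gaussMoment]

theorem hermitePoly_four (c : ℝ) : hermitePoly c 4 = Polynomial.X ^ 4
    - Polynomial.C (6 * c) * Polynomial.X ^ 2 + Polynomial.C (3 * c ^ 2) := by
  simp only [hermitePoly, Polynomial.derivative_sub, Polynomial.derivative_mul,
    Polynomial.derivative_X, Polynomial.derivative_C, Polynomial.derivative_one, map_mul, map_pow,
    mul_one, mul_zero, zero_mul, sub_zero, zero_add, one_mul, Polynomial.derivative_add]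
  rw [show Polynomial.C (6 : ℝ) = 6 from map_ofNat _ 6,
    show Polynomial.C (3 : ℝ) = 3 from map_ofNat _ 3]
  ring

theorem iterate_derivative_hermitePoly_four (c : ℝ) :
    Polynomial.derivative^[4] (hermitePoly c 4) = Polynomial.C 24 := by
  have h1 : Polynomial.derivative^[4] (Polynomial.X ^ 4 : Polynomial ℝ) = Polynomial.C 24 := by
    rw [Polynomial.iterate_derivative_X_pow_eq_C_mul]
    norm_num [Nat.descFactorial]
  have h2 : Polynomial.derivative^[4] (Polynomial.C (6 * c) * Polynomial.X ^ 2) = 0 := by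
    rw [Polynomial.iterate_derivative_C_mul, Polynomial.iterate_derivative_X_pow_eq_C_mul]
    norm_num [Nat.descFactorial]
  rw [hermitePoly_four, iterate_map_add, Polynomial.iterate_derivative_sub, h1,
    h2, Polynomial.iterate_derivative_C (by norm_num)]
  simp

/-- Wick's formula `E[H₄(X, E X²) H₄(Y, c)] = 24 E[XY]⁴` for Gaussian linear forms `X` and `Y`. -/
theorem gaussE_hermite_four_mul (a b : ι → ℝ) (c : ℝ) :
    gaussE ι (Polynomial.aeval (linForm a) (hermitePoly (∑ i, a i * a i) 4)
      * Polynomial.aeval (linForm b) (hermitePoly c 4)) = 24 * (∑ i, a i * b i) ^ 4 := by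
  rw [gaussE_hermite_mul, iterate_derivative_hermitePoly_four, Polynomial.aeval_C,
    MvPolynomial.algebraMap_eq, ← mul_one (MvPolynomial.C _), ← MvPolynomial.smul_eq_C_mul,
    map_smul, gaussE_one, smul_eq_mul, mul_one, mul_comm]

end GaussianPolynomials

/-! ### Bonami's inequality on the discrete cube -/

/-- The sign encoded by a Boolean. -/
def sgn (b : Bool) : ℝ := if b then 1 else -1

theorem sgn_not (b : Bool) : sgn (!b) = -sgn b := by cases b <;> simp [sgn]

theorem sgn_mul_self (b : Bool) : sgn b * sgn b = 1 := by cases b <;> simp [sgn]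

section Walsh

variable {κ : Type*} [DecidableEq κ]

/-- Flipping the sign with index `a`. -/
def flip (a : κ) (ε : κ → Bool) : κ → Bool := Function.update ε a (!ε a)

theorem flip_flip (a : κ) (ε : κ → Bool) : flip a (flip a ε) = ε := by
  simp [flip]

/-- The Walsh character `∏ i ∈ S, ε i`. -/
def walshChar (S : Finset κ) (ε : κ → Bool) : ℝ := ∏ i ∈ S, sgn (ε i)

/-- The function on the cube with Walsh coefficients `c`, depending on the variables in `V`. -/
def walshSum (V : Finset κ) (c : Finset κ → ℝ) (ε : κ → Bool) : ℝ :=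
  ∑ S ∈ V.powerset, c S * walshChar S ε

theorem walshSum_flip {a : κ} {V : Finset κ} (ha : a ∉ V) (c : Finset κ → ℝ) (ε : κ → Bool) :
    walshSum V c (flip a ε) = walshSum V c ε := by
  refine Finset.sum_congr rfl fun S hS => ?_
  congr 1
  refine Finset.prod_congr rfl fun i hi => ?_
  have : i ≠ a := fun h => ha (h ▸ Finset.mem_powerset.1 hS hi)
  simp [flip, this]

theorem walshSum_insert {a : κ} {V : Finset κ} (ha : a ∉ V) (c : Finset κ → ℝ) (ε : κ → Bool) :
    walshSum (insert a V) c ε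
      = walshSum V c ε + sgn (ε a) * walshSum V (fun S => c (insert a S)) ε := by
  rw [walshSum, Finset.sum_powerset_insert ha, walshSum, walshSum, Finset.mul_sum]
  congr 1
  refine Finset.sum_congr rfl fun S hS => ?_
  rw [walshChar, Finset.prod_insert fun h => ha (Finset.mem_powerset.1 hS h), walshChar]
  ring

end Walsh

section Cube

variable {κ : Type*} [Fintype κ] [DecidableEq κ]

/-- The average of a function over the discrete cube. -/
def cubeE (f : (κ → Bool) → ℝ) : ℝ := (∑ ε, f ε) / Fintype.card (κ → Bool)

theorem cubeE_add (f g : (κ → Bool) → ℝ) :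
    cubeE (fun ε => f ε + g ε) = cubeE f + cubeE g := by
  simp [cubeE, Finset.sum_add_distrib, add_div]

theorem cubeE_const_mul (c : ℝ) (f : (κ → Bool) → ℝ) :
    cubeE (fun ε => c * f ε) = c * cubeE f := by
  simp [cubeE, ← Finset.mul_sum, mul_div_assoc]

theorem cubeE_sum {α : Type*} (s : Finset α) (f : α → (κ → Bool) → ℝ) :
    cubeE (fun ε => ∑ j ∈ s, f j ε) = ∑ j ∈ s, cubeE (f j) := by
  simp only [cubeE]
  rw [Finset.sum_comm, Finset.sum_div]

theorem cubeE_const (c : ℝ) : cubeE (fun _ : κ → Bool => c) = c := by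
  simp [cubeE]

theorem cubeE_nonneg {f : (κ → Bool) → ℝ} (hf : ∀ ε, 0 ≤ f ε) : 0 ≤ cubeE f :=
  div_nonneg (Finset.sum_nonneg fun ε _ => hf ε) (by positivity)

/-- The Cauchy–Schwarz inequality on the cube. -/
theorem cubeE_mul_sq_le (f g : (κ → Bool) → ℝ) :
    cubeE (fun ε => f ε * g ε) ^ 2 ≤ cubeE (fun ε => f ε ^ 2) * cubeE (fun ε => g ε ^ 2) := by
  simp only [cubeE]
  rw [div_pow, div_mul_div_comm, ← sq]
  gcongr
  exact Finset.sum_mul_sq_le_sq_mul_sq _ _ _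

theorem cubeE_flip (a : κ) (f : (κ → Bool) → ℝ) : cubeE (fun ε => f (flip a ε)) = cubeE f := by
  unfold cubeE
  congr 1
  exact Equiv.sum_comp (Function.Involutive.toPerm (flip a) (flip_flip a)) f

theorem cubeE_sgn_mul_eq_zero (a : κ) {f : (κ → Bool) → ℝ} (hf : ∀ ε, f (flip a ε) = f ε) :
    cubeE (fun ε => sgn (ε a) * f ε) = 0 := by
  have h := cubeE_flip a (fun ε => sgn (ε a) * f ε)
  have h2 : (fun ε => sgn (flip a ε a) * f (flip a ε)) = fun ε => (-1) * (sgn (ε a) * f ε) := by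
    funext ε
    rw [hf]
    simp [flip, sgn_not]
  rw [h2, cubeE_const_mul] at h
  linarith

/-- Bonami's inequality: on functions of degree at most `d` on the cube, the fourth moment is
controlled by the second one, with a constant that does not depend on the number of variables. -/
theorem cubeE_walshSum_pow_four_le (V : Finset κ) (d : ℕ) (c : Finset κ → ℝ)
    (hc : ∀ S ⊆ V, d < S.card → c S = 0) :
    cubeE (fun ε => walshSum V c ε ^ 4) ≤ 9 ^ d * cubeE (fun ε => walshSum V c ε ^ 2) ^ 2 := by
  induction V using Finset.induction_on generalizing d c with
  | empty =>
    simp only [walshSum, walshChar, Finset.powerset_empty, Finset.sum_singleton,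
      Finset.prod_empty, mul_one, cubeE_const]
    rw [← pow_mul]
    exact le_mul_of_one_le_left (by positivity) (one_le_pow₀ (by norm_num))
  | insert a V ha ih =>
    set A := walshSum V c with hA
    set B := walshSum V (fun S => c (insert a S)) with hB
    have hcard : ∀ S ⊆ V, (insert a S).card = S.card + 1 := fun S hS =>
      Finset.card_insert_of_notMem fun h => ha (hS h)
    have hAf : ∀ ε, A (flip a ε) = A ε := walshSum_flip ha c
    have hBf : ∀ ε, B (flip a ε) = B ε := walshSum_flip ha _
    have hx : cubeE (fun ε => A ε ^ 4) ≤ 9 ^ d * cubeE (fun ε => A ε ^ 2) ^ 2 :=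
      ih d c fun S hS h => hc S (hS.trans (Finset.subset_insert _ _)) h
    -- `B` has degree at most `d - 1`, which gains a factor `9`.
    have hy : 9 * cubeE (fun ε => B ε ^ 4) ≤ 9 ^ d * cubeE (fun ε => B ε ^ 2) ^ 2 := by
      cases d with
      | zero =>
        have hB0 : ∀ ε, B ε = 0 := fun ε => Finset.sum_eq_zero fun S hS => by
          have hS := Finset.mem_powerset.1 hS
          simp only
          rw [hc _ (Finset.insert_subset_insert _ hS) (by rw [hcard S hS]; omega), zero_mul]
        simp [hB0, cubeE_const]
      | succ d =>
        have := ih d (fun S => c (insert a S)) fun S hS h =>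
          hc _ (Finset.insert_subset_insert _ hS) (by rw [hcard S hS]; omega)
        rw [pow_succ]
        linarith
    have hz := cubeE_mul_sq_le (fun ε => A ε ^ 2) (fun ε => B ε ^ 2)
    simp only [← pow_mul, Nat.reduceMul] at hz
    have h2 : cubeE (fun ε => walshSum (insert a V) c ε ^ 2)
        = cubeE (fun ε => A ε ^ 2) + cubeE (fun ε => B ε ^ 2) := by
      have h0 := cubeE_sgn_mul_eq_zero a (f := fun ε => 2 * A ε * B ε) (by simp [hAf, hBf])
      rw [← add_zero (_ + _), ← h0, ← cubeE_add, ← cubeE_add]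
      congr 1 with ε
      rw [walshSum_insert ha]
      linear_combination B ε ^ 2 * sgn_mul_self (ε a)
    have h4 : cubeE (fun ε => walshSum (insert a V) c ε ^ 4)
        = cubeE (fun ε => A ε ^ 4) + 6 * cubeE (fun ε => A ε ^ 2 * B ε ^ 2)
          + cubeE (fun ε => B ε ^ 4) := by
      have h0 := cubeE_sgn_mul_eq_zero a
        (f := fun ε => 4 * A ε ^ 3 * B ε + 4 * A ε * B ε ^ 3) (by simp [hAf, hBf])
      rw [← add_zero (_ + _), ← h0, ← cubeE_const_mul, ← cubeE_add, ← cubeE_add, ← cubeE_add]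
      congr 1 with ε
      rw [walshSum_insert ha]
      have h := sgn_mul_self (ε a)
      linear_combination (6 * A ε ^ 2 * B ε ^ 2 + 4 * sgn (ε a) * A ε * B ε ^ 3
        + B ε ^ 4 * (sgn (ε a) * sgn (ε a) + 1)) * h
    rw [h2, h4]
    have hP : 0 ≤ cubeE (fun ε => A ε ^ 2) := cubeE_nonneg fun ε => sq_nonneg _
    have hQ : 0 ≤ cubeE (fun ε => B ε ^ 2) := cubeE_nonneg fun ε => sq_nonneg _
    have hx0 : 0 ≤ cubeE (fun ε => A ε ^ 4) := cubeE_nonneg fun ε => by positivity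
    have hy0 : 0 ≤ cubeE (fun ε => B ε ^ 4) := cubeE_nonneg fun ε => by positivity
    generalize cubeE (fun ε => A ε ^ 4) = x at *
    generalize cubeE (fun ε => B ε ^ 4) = y at *
    generalize cubeE (fun ε => A ε ^ 2 * B ε ^ 2) = z at *
    generalize cubeE (fun ε => A ε ^ 2) = P at *
    generalize cubeE (fun ε => B ε ^ 2) = Q at *
    have hK : (0 : ℝ) < 9 ^ d := by positivity
    generalize (9 : ℝ) ^ d = K at *
    have h3 : 3 * z ≤ K * P * Q := by
      refine le_of_sq_le_sq ?_ (by positivity)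
      have : x * (9 * y) ≤ (K * P ^ 2) * (K * Q ^ 2) := by gcongr
      nlinarith
    nlinarith

/-- A polynomial of total degree at most `d`, restricted to the cube, has Walsh degree at most
`d`: even powers of a sign are `1`. -/
theorem exists_walshSum_eq_eval (p : MvPolynomial κ ℝ) :
    ∃ c : Finset κ → ℝ, (∀ S, p.totalDegree < S.card → c S = 0) ∧
      ∀ ε, MvPolynomial.eval (fun i => sgn (ε i)) p = walshSum Finset.univ c ε := by
  classical
  let odd : (κ →₀ ℕ) → Finset κ := fun α => Finset.univ.filter fun i => Odd (α i)
  refine ⟨fun S => ∑ α ∈ p.support.filter fun α => odd α = S, p.coeff α, fun S hS => ?_,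
    fun ε => ?_⟩
  · refine Finset.sum_eq_zero fun α hα => ?_
    obtain ⟨h1, rfl⟩ := Finset.mem_filter.1 hα
    exfalso
    have h2 : (odd α).card ≤ ∑ i, α i := by
      rw [Finset.card_eq_sum_ones]
      refine (Finset.sum_le_sum fun i hi => ?_).trans
        (Finset.sum_le_sum_of_subset (Finset.subset_univ _))
      exact (Finset.mem_filter.1 hi).2.pos
    have h3 := MvPolynomial.le_totalDegree h1
    rw [Finsupp.sum_fintype _ _ fun _ => rfl] at h3
    omega
  · rw [MvPolynomial.eval_eq', walshSum, Finset.powerset_univ]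
    simp only [Finset.sum_mul]
    rw [← Finset.sum_fiberwise p.support odd]
    refine Finset.sum_congr rfl fun S _ => Finset.sum_congr rfl fun α hα => ?_
    congr 1
    obtain ⟨-, rfl⟩ := Finset.mem_filter.1 hα
    rw [walshChar, Finset.prod_filter]
    refine Finset.prod_congr rfl fun i _ => ?_
    have h := sgn_mul_self (ε i)
    rw [← sq] at h
    split_ifs with ho
    · obtain ⟨k, hk⟩ := ho
      rw [hk, pow_succ, pow_mul, h, one_pow, one_mul]
    · obtain ⟨k, hk⟩ := (Nat.not_odd_iff_even.1 ho).two_dvd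
      rw [hk, pow_mul, h, one_pow]

theorem cubeE_eval_pow_four_le (p : MvPolynomial κ ℝ) {d : ℕ} (hp : p.totalDegree ≤ d) :
    cubeE (fun ε : κ → Bool => MvPolynomial.eval (fun i => sgn (ε i)) p ^ 4)
      ≤ 9 ^ d * cubeE (fun ε : κ → Bool => MvPolynomial.eval (fun i => sgn (ε i)) p ^ 2) ^ 2 := by
  obtain ⟨c, hc, h⟩ := exists_walshSum_eq_eval p
  simp only [h]
  exact cubeE_walshSum_pow_four_le _ _ _ fun S _ hS => hc S (hp.trans_lt hS)

end Cube

/-! ### Gaussian hypercontractivity for polynomials -/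

section Hypercontractivity

open Filter Topology

/-- The normalised sum of the `m + 1` signs of `η`. -/
def signSum (m : ℕ) (η : Fin (m + 1) → Bool) : ℝ := (√(m + 1))⁻¹ * ∑ j, sgn (η j)

/-- The moments of the normalised sum of `m + 1` independent signs. -/
def signMoment (m k : ℕ) : ℝ := cubeE fun η => signSum m η ^ k

theorem signSum_flip (m : ℕ) (j : Fin (m + 1)) (η : Fin (m + 1) → Bool) :
    signSum m (flip j η) = signSum m η + -(2 * (√(m + 1))⁻¹ * sgn (η j)) := by
  have h : ∑ i, sgn (flip j η i) = ∑ i, sgn (η i) - 2 * sgn (η j) := by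
    rw [← Finset.add_sum_erase _ _ (Finset.mem_univ j),
      ← Finset.add_sum_erase _ (fun i => sgn (η i)) (Finset.mem_univ j)]
    have h2 : ∀ i ∈ Finset.univ.erase j, sgn (flip j η i) = sgn (η i) := fun i hi => by
      simp [flip, Finset.ne_of_mem_erase hi]
    rw [Finset.sum_congr rfl h2]
    simp [flip, sgn_not]
    ring
  rw [signSum, signSum, h]
  ring

/-- The factor `√(m + 1)⁻¹ * ∑ j, E[ε_j ^ (l + 1) S ^ (k - l)]` of the binomial expansion in
`signMoment_succ`, where `S` is the normalised sum of the signs `ε_j`; see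
`signMomentWeight_eq`. -/
def signMomentWeight (m k l : ℕ) : ℝ :=
  if Odd l then (√(m + 1))⁻¹ * (m + 1) * signMoment m (k - l) else signMoment m (k - l + 1)

theorem signMomentWeight_eq (m k l : ℕ) :
    signMomentWeight m k l = (√(m + 1))⁻¹ * ∑ j : Fin (m + 1),
      cubeE fun η => sgn (η j) ^ (l + 1) * signSum m η ^ (k - l) := by
  have h2 : ∀ b, sgn b ^ 2 = 1 := fun b => by rw [sq, sgn_mul_self]
  unfold signMomentWeight
  split_ifs with hl
  · obtain ⟨r, rfl⟩ := hl
    simp only [show 2 * r + 1 + 1 = 2 * (r + 1) by ring, pow_mul, h2, one_pow, one_mul]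
    simp [signMoment, mul_assoc]
  · obtain ⟨r, rfl⟩ := (Nat.not_odd_iff_even.1 hl).two_dvd
    simp only [pow_succ (sgn _) (2 * r), pow_mul, h2, one_pow, one_mul]
    rw [← cubeE_sum, ← cubeE_const_mul, signMoment]
    congr 1 with η
    rw [← Finset.sum_mul, ← mul_assoc, ← signSum, pow_succ']

/-- A discrete integration by parts: flip each sign in turn and expand. -/
theorem signMoment_succ (m k : ℕ) : signMoment m (k + 1)
    = -∑ l ∈ Finset.range (k + 1),
      (k.choose l : ℝ) * (-(2 * (√(m + 1))⁻¹)) ^ l * signMomentWeight m k l := by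
  have h1 : signMoment m (k + 1) = (√(m + 1))⁻¹ * ∑ j : Fin (m + 1),
      cubeE fun η => sgn (η j) * signSum m η ^ k := by
    have := signMomentWeight_eq m k 0
    simpa [signMomentWeight] using this
  have h2 : ∀ j : Fin (m + 1), (cubeE fun η => sgn (η j) * signSum m η ^ k)
      = -∑ l ∈ Finset.range (k + 1), (k.choose l : ℝ) * (-(2 * (√(m + 1))⁻¹)) ^ l
        * cubeE fun η => sgn (η j) ^ (l + 1) * signSum m η ^ (k - l) := by
    intro j
    rw [← cubeE_flip j, ← neg_one_mul, ← Finset.sum_congr rfl fun l _ => cubeE_const_mul _ _,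
      ← cubeE_sum, ← cubeE_const_mul]
    congr 1 with η
    rw [signSum_flip, add_comm (signSum m η), add_pow, Finset.mul_sum, Finset.mul_sum]
    refine Finset.sum_congr rfl fun l _ => ?_
    have : sgn (flip j η j) = -sgn (η j) := by simp [flip, sgn_not]
    rw [this, neg_mul_eq_neg_mul, mul_pow, pow_succ]
    ring
  rw [h1]
  simp only [h2, signMomentWeight_eq]
  rw [Finset.sum_neg_distrib, Finset.sum_comm, mul_neg, Finset.mul_sum]
  congr 1
  refine Finset.sum_congr rfl fun l _ => ?_
  rw [← Finset.mul_sum]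
  ring

theorem tendsto_inv_sqrt_succ : Tendsto (fun m : ℕ => (√(m + 1 : ℝ))⁻¹) atTop (𝓝 0) := by
  refine tendsto_inv_atTop_zero.comp (Real.tendsto_sqrt_atTop.comp ?_)
  exact tendsto_atTop_add_const_right _ _ tendsto_natCast_atTop_atTop

/-- The central limit theorem for random signs, for moments: in the recursion `signMoment_succ` the
term `l = 0` is a multiple of the left-hand side, the term `l = 1` yields the recursion for
`gaussMoment`, and the terms with `l ≥ 2` vanish in the limit. -/
theorem tendsto_signMoment (k : ℕ) :
    Tendsto (fun m => signMoment m k) atTop (𝓝 (gaussMoment k)) := by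
  induction k using Nat.strong_induction_on with
  | _ k ih =>
  have hδ : ∀ m : ℕ, (√(m + 1 : ℝ))⁻¹ * (√(m + 1 : ℝ))⁻¹ * (m + 1) = 1 := fun m => by
    have h : (0 : ℝ) < m + 1 := by positivity
    rw [← mul_inv, Real.mul_self_sqrt h.le, inv_mul_cancel₀ h.ne']
  match k with
  | 0 => simp [signMoment, cubeE_const, gaussMoment]
  | 1 =>
    have h : ∀ m, signMoment m 1 = 0 := fun m => by
      have := signMoment_succ m 0
      simp [signMomentWeight] at this
      linarith
    simp [h, gaussMoment]
  | k + 2 =>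
    have h : ∀ m, signMoment m (k + 2) = (k + 1) * signMoment m k
        + -(1 / 2) * ∑ l ∈ Finset.range k, ((k + 1).choose (l + 2) : ℝ) *
          ((-(2 * (√(m + 1 : ℝ))⁻¹)) ^ (l + 2) * signMomentWeight m (k + 1) (l + 2)) := fun m => by
      have h := signMoment_succ m (k + 1)
      rw [Finset.sum_range_succ', Finset.sum_range_succ'] at h
      have w0 : signMomentWeight m (k + 1) 0 = signMoment m (k + 2) := by simp [signMomentWeight]
      have w1 : signMomentWeight m (k + 1) (0 + 1)
          = (√(m + 1 : ℝ))⁻¹ * (m + 1) * signMoment m k := by simp [signMomentWeight]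
      rw [w0, w1] at h
      simp only [zero_add, Nat.choose_zero_right, pow_zero, Nat.choose_one_right, pow_one,
        add_assoc, Nat.reduceAdd] at h
      simp only [← mul_assoc] at h ⊢
      push_cast at h
      linear_combination (1 / 2) * h + (k + 1) * signMoment m k * hδ m
    have hterm : ∀ l ∈ Finset.range k, Tendsto (fun m : ℕ => ((k + 1).choose (l + 2) : ℝ) *
        ((-(2 * (√(m + 1 : ℝ))⁻¹)) ^ (l + 2) * signMomentWeight m (k + 1) (l + 2))) atTop
          (𝓝 (((k + 1).choose (l + 2) : ℝ) * 0)) := by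
      intro l hl
      refine Tendsto.const_mul _ ?_
      have hl := Finset.mem_range.1 hl
      by_cases ho : Odd (l + 2)
      · have he : ∀ m : ℕ, (-(2 * (√(m + 1 : ℝ))⁻¹)) ^ (l + 2) * signMomentWeight m (k + 1) (l + 2)
            = (-2) ^ (l + 2) * ((√(m + 1 : ℝ))⁻¹ ^ (l + 1) * signMoment m (k + 1 - (l + 2))) := by
          intro m
          rw [signMomentWeight, if_pos ho, ← neg_mul, mul_pow, pow_succ _ (l + 1)]
          linear_combination (-2) ^ (l + 2) * (√(m + 1 : ℝ))⁻¹ ^ (l + 1)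
            * signMoment m (k + 1 - (l + 2)) * hδ m
        simp only [he]
        have := ((tendsto_inv_sqrt_succ.pow (l + 1)).mul
          (ih (k + 1 - (l + 2)) (by omega))).const_mul ((-2 : ℝ) ^ (l + 2))
        simpa using this
      · simp only [signMomentWeight, if_neg ho]
        have := ((tendsto_inv_sqrt_succ.const_mul 2).neg.pow (l + 2)).mul
          (ih (k + 1 - (l + 2) + 1) (by omega))
        simpa using this
    have := (((ih k (by omega)).const_mul ((k : ℝ) + 1)).add
      ((tendsto_finsetSum _ hterm).const_mul (-(1 / 2))))
    simp only [h, gaussMoment]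
    simpa using this

variable {ι : Type*} [Fintype ι] [DecidableEq ι]

/-- Independence of blocks of signs. -/
theorem cubeE_prod (m : ℕ) (h : ι → (Fin (m + 1) → Bool) → ℝ) :
    cubeE (fun ε : ι × Fin (m + 1) → Bool => ∏ i, h i fun j => ε (i, j)) = ∏ i, cubeE (h i) := by
  simp only [cubeE]
  rw [Finset.prod_div_distrib, Finset.prod_univ_sum, Fintype.piFinset_univ]
  congr 1
  · exact Fintype.sum_equiv (Equiv.curry ι (Fin (m + 1)) Bool) _ _ fun ε => rfl
  · simp
    rw [← pow_mul, mul_comm]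

/-- The expectation of a polynomial in independent normalised sums of `m + 1` signs. -/
def signE (m : ℕ) (p : MvPolynomial ι ℝ) : ℝ :=
  cubeE fun ε : ι × Fin (m + 1) → Bool =>
    MvPolynomial.eval (fun i => signSum m fun j => ε (i, j)) p

theorem tendsto_signE (p : MvPolynomial ι ℝ) :
    Tendsto (fun m => signE m p) atTop (𝓝 (gaussE ι p)) := by
  induction p using MvPolynomial.induction_on' with
  | add p q hp hq =>
    simpa [signE, cubeE_add] using hp.add hq
  | monomial α c =>
    have h : ∀ m, signE m (MvPolynomial.monomial α c) = c * ∏ i, signMoment m (α i) := by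
      intro m
      simp only [signE, MvPolynomial.eval_monomial, cubeE_const_mul, signMoment]
      rw [← cubeE_prod]
      congr 2 with ε
      exact Finsupp.prod_fintype _ _ fun _ => pow_zero _
    simp only [h, gaussE_monomial]
    exact (tendsto_finsetProd _ fun i _ => tendsto_signMoment (α i)).const_mul c

theorem totalDegree_aeval_le {σ τ : Type*} (f : σ → MvPolynomial τ ℝ)
    (hf : ∀ i, (f i).totalDegree ≤ 1) (p : MvPolynomial σ ℝ) :
    (MvPolynomial.aeval f p).totalDegree ≤ p.totalDegree := by
  rw [MvPolynomial.aeval_def, MvPolynomial.eval₂_eq]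
  refine MvPolynomial.totalDegree_finsetSum_le fun α hα => ?_
  refine (MvPolynomial.totalDegree_mul _ _).trans ?_
  rw [MvPolynomial.algebraMap_eq, MvPolynomial.totalDegree_C, zero_add]
  refine (MvPolynomial.totalDegree_finsetProd _ _).trans
    (le_trans ?_ (MvPolynomial.le_totalDegree hα))
  refine Finset.sum_le_sum fun i _ => (MvPolynomial.totalDegree_pow _ _).trans ?_
  exact (Nat.mul_le_mul_left _ (hf i)).trans (mul_one _).le

theorem signE_pow_four_le (m : ℕ) (p : MvPolynomial ι ℝ) {d : ℕ} (hp : p.totalDegree ≤ d) :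
    signE m (p ^ 4) ≤ 9 ^ d * signE m (p ^ 2) ^ 2 := by
  let f : ι → MvPolynomial (ι × Fin (m + 1)) ℝ := fun i =>
    ∑ j, MvPolynomial.C (√(m + 1 : ℝ))⁻¹ * MvPolynomial.X (i, j)
  have hf : ∀ i, (f i).totalDegree ≤ 1 := fun i => by
    refine MvPolynomial.totalDegree_finsetSum_le fun j _ => ?_
    refine (MvPolynomial.totalDegree_mul _ _).trans ?_
    simp
  have h := cubeE_eval_pow_four_le (MvPolynomial.aeval f p) ((totalDegree_aeval_le f hf p).trans hp)
  have he : ∀ ε : ι × Fin (m + 1) → Bool,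
      MvPolynomial.eval (fun i => sgn (ε i)) (MvPolynomial.aeval f p)
        = MvPolynomial.eval (fun i => signSum m fun j => ε (i, j)) p := by
    intro ε
    rw [← MvPolynomial.coe_aeval_eq_eval, ← MvPolynomial.coe_aeval_eq_eval]
    simp only [RingHom.coe_coe]
    rw [← AlgHom.comp_apply, MvPolynomial.comp_aeval]
    congr 2 with i
    simp [f, signSum, Finset.mul_sum]
  simpa only [he, signE, map_pow] using h

/-- Fourth moments of Gaussian polynomials of degree at most `d`. -/
theorem gaussE_pow_four_le (p : MvPolynomial ι ℝ) {d : ℕ} (hp : p.totalDegree ≤ d) :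
    gaussE ι (p ^ 4) ≤ 9 ^ d * gaussE ι (p ^ 2) ^ 2 :=
  le_of_tendsto_of_tendsto' (tendsto_signE _) (((tendsto_signE _).pow 2).const_mul _)
    fun m => signE_pow_four_le m p hp

theorem gaussE_sq_nonneg (p : MvPolynomial ι ℝ) : 0 ≤ gaussE ι (p ^ 2) :=
  ge_of_tendsto' (tendsto_signE _) fun m => cubeE_nonneg fun ε => by
    rw [map_pow]; positivity

/-- Hypercontractivity along powers of two: the `2 ^ (j + 1)`-th moment of a Gaussian polynomial of
degree at most `4`. -/
theorem gaussE_pow_two_pow_le (p : MvPolynomial ι ℝ) (hp : p.totalDegree ≤ 4) (j : ℕ) :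
    gaussE ι (p ^ 2 ^ (j + 1)) ≤ (81 ^ j * gaussE ι (p ^ 2)) ^ 2 ^ j := by
  induction j with
  | zero => simp
  | succ j ih =>
    have h0 : 0 ≤ gaussE ι (p ^ 2 ^ (j + 1)) := by
      rw [pow_succ, pow_mul]
      exact gaussE_sq_nonneg _
    have h1 := gaussE_pow_four_le (p ^ 2 ^ j) (d := 2 ^ j * 4)
      ((MvPolynomial.totalDegree_pow _ _).trans (Nat.mul_le_mul_left _ hp))
    rw [← pow_mul, ← pow_mul, show 2 ^ j * 4 = 2 ^ (j + 1 + 1) by ring, ← pow_succ] at h1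
    refine h1.trans ?_
    calc (9 : ℝ) ^ 2 ^ (j + 1 + 1) * gaussE ι (p ^ 2 ^ (j + 1)) ^ 2
        ≤ 9 ^ 2 ^ (j + 1 + 1) * ((81 ^ j * gaussE ι (p ^ 2)) ^ 2 ^ j) ^ 2 := by gcongr
      _ = (81 ^ (j + 1) * gaussE ι (p ^ 2)) ^ 2 ^ (j + 1) := by
        rw [← pow_mul, ← pow_succ, pow_succ 2 (j + 1), mul_comm _ 2, pow_mul, ← mul_pow]
        congr 1
        ring

end Hypercontractivity

/-! ### The Gaussian field in independent standard coordinates -/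

theorem integrable_pow_mul_exp (k : ℕ) :
    Integrable fun x : ℝ => x ^ k * Real.exp (-(x ^ 2 / 2)) := by
  have h := integrable_rpow_mul_exp_neg_mul_sq (b := 1 / 2) (by norm_num) (s := k)
    (by have : (0 : ℝ) ≤ k := k.cast_nonneg
        linarith)
  refine h.congr (Filter.Eventually.of_forall fun x => ?_)
  simp only [Real.rpow_natCast]
  congr 2
  ring

theorem hasDerivAt_exp_neg_sq (x : ℝ) :
    HasDerivAt (fun x : ℝ => Real.exp (-(x ^ 2 / 2))) (-x * Real.exp (-(x ^ 2 / 2))) x := by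
  have h : HasDerivAt (fun x : ℝ => -(x ^ 2 / 2)) (-x) x :=
    ((hasDerivAt_pow 2 x).div_const 2).neg.congr_deriv (by simp)
  exact h.exp.congr_deriv (mul_comm _ _)

theorem integral_pow_mul_exp (k : ℕ) : ∫ x : ℝ, x ^ k * Real.exp (-(x ^ 2 / 2))
    = gaussMoment k * ∫ x : ℝ, Real.exp (-(x ^ 2 / 2)) := by
  induction k using Nat.strong_induction_on with
  | _ k ih =>
  match k with
  | 0 => simp [gaussMoment]
  | 1 =>
    have h := integral_eq_zero_of_hasDerivAt_of_integrable hasDerivAt_exp_neg_sq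
      (by simpa using (integrable_pow_mul_exp 1).neg) (by simpa using integrable_pow_mul_exp 0)
    simp only [neg_mul, integral_neg, neg_eq_zero] at h
    simp [gaussMoment, h]
  | k + 2 =>
    have hd : ∀ x : ℝ, HasDerivAt (fun x : ℝ => x ^ (k + 1) * Real.exp (-(x ^ 2 / 2)))
        ((k + 1) * (x ^ k * Real.exp (-(x ^ 2 / 2)))
          - x ^ (k + 2) * Real.exp (-(x ^ 2 / 2))) x := fun x => by
      refine ((hasDerivAt_pow (k + 1) x).mul (hasDerivAt_exp_neg_sq x)).congr_deriv ?_
      push_cast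
      ring
    have h := integral_eq_zero_of_hasDerivAt_of_integrable hd
      (((integrable_pow_mul_exp k).const_mul _).sub (integrable_pow_mul_exp (k + 2)))
      (integrable_pow_mul_exp (k + 1))
    rw [integral_sub ((integrable_pow_mul_exp k).const_mul _) (integrable_pow_mul_exp (k + 2)),
      integral_const_mul, ih k (by omega)] at h
    rw [gaussMoment]
    linarith

theorem eigenval_neg (L : ℝ) (k : ℤ × ℤ) : eigenval L (-k) = eigenval L k := by
  simp [eigenval]

theorem eigenval_ne_zero {L : ℝ} (h0 : 0 < L) (hL : L < 2 * Real.pi) (k : ℤ × ℤ) :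
    eigenval L k ≠ 0 := by
  by_cases hk : k = 0
  · simp [hk, eigenval]
  · exact (eigenval_pos h0 hL hk).ne'

/-- The involution `k ↦ -k` of the modes. -/
def negMode {N : ℕ} (k : modes N) : modes N := ⟨-k.1, neg_mem_modes k.2⟩

theorem negMode_negMode {N : ℕ} (k : modes N) : negMode (negMode k) = k :=
  Subtype.ext (neg_neg k.1)

theorem sum_negMode {N : ℕ} {E : Type*} [AddCommMonoid E] (f : modes N → E) :
    ∑ k, f (negMode k) = ∑ k, f k :=
  Equiv.sum_comp (Function.Involutive.toPerm negMode negMode_negMode) f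

/-- The standard deviation `|λ_k|^{-1/2}` of the mode `k`. -/
def modeStd (L : ℝ) (k : ℤ × ℤ) : ℝ := (√|eigenval L k|)⁻¹

theorem modeStd_pos {L : ℝ} (h0 : 0 < L) (hL : L < 2 * Real.pi) (k : ℤ × ℤ) :
    0 < modeStd L k :=
  inv_pos.2 (Real.sqrt_pos.2 (abs_pos.2 (eigenval_ne_zero h0 hL k)))

theorem modeStd_neg (L : ℝ) (k : ℤ × ℤ) : modeStd L (-k) = modeStd L k := by
  rw [modeStd, eigenval_neg, modeStd]

theorem modeStd_mul_self (L : ℝ) (k : ℤ × ℤ) : modeStd L k * modeStd L k = 1 / |eigenval L k| := by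
  rw [modeStd, ← mul_inv, Real.mul_self_sqrt (abs_nonneg _), one_div]

/-- Real coordinates `g_k = (Re y_k + Im y_k) / |λ_k|^{-1/2}` on the coefficient space. They
involve no choice of a half-space of modes, and turn the quadratic form into `½ ∑ g_k²`. -/
def coordEquiv {L : ℝ} (h0 : 0 < L) (hL : L < 2 * Real.pi) (N : ℕ) :
    coeffSpace N ≃ₗ[ℝ] (modes N → ℝ) where
  toFun y k := ((y : EuclideanSpace ℂ (modes N)) k).re / modeStd L k
    + ((y : EuclideanSpace ℂ (modes N)) k).im / modeStd L k
  map_add' y z := by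
    funext k
    simp
    ring
  map_smul' c y := by
    funext k
    simp
    ring
  invFun g := ⟨WithLp.toLp 2 fun k => ⟨modeStd L k * ((g k + g (negMode k)) / 2),
      modeStd L k * ((g k - g (negMode k)) / 2)⟩, by
    intro k l h
    obtain rfl : l = negMode k := Subtype.ext h
    apply Complex.ext
    · simp [negMode_negMode]
      simp [negMode, modeStd_neg, add_comm]
    · simp [negMode_negMode]
      simp [negMode, modeStd_neg]
      ring⟩
  left_inv y := by
    ext k
    have h := y.2 k (negMode k) rfl
    have hs := (modeStd_pos h0 hL k).ne'
    have hn : modeStd L (negMode k) = modeStd L k := modeStd_neg L k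
    simp only [h, hn, Complex.conj_re, Complex.conj_im]
    apply Complex.ext
    · simp
      field_simp
      ring
    · simp
      field_simp
      ring
  right_inv g := by
    funext k
    have hs := (modeStd_pos h0 hL k).ne'
    simp
    field_simp
    ring

theorem coordEquiv_symm_apply {L : ℝ} (h0 : 0 < L) (hL : L < 2 * Real.pi) {N : ℕ}
    (g : modes N → ℝ) (k : modes N) :
    ((coordEquiv h0 hL N).symm g : EuclideanSpace ℂ (modes N)) k
      = ⟨modeStd L k * ((g k + g (negMode k)) / 2),
        modeStd L k * ((g k - g (negMode k)) / 2)⟩ := rfl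

theorem quadForm_coordEquiv_symm {L : ℝ} (h0 : 0 < L) (hL : L < 2 * Real.pi) {N : ℕ}
    (g : modes N → ℝ) : quadForm L ((coordEquiv h0 hL N).symm g) = ∑ k, g k ^ 2 / 2 := by
  have h : ∀ k : modes N, |eigenval L k|
      * ‖((coordEquiv h0 hL N).symm g : EuclideanSpace ℂ (modes N)) k‖ ^ 2
      = g k ^ 2 / 2 + g (negMode k) ^ 2 / 2 := fun k => by
    have h1 : |eigenval L k| * (modeStd L k * modeStd L k) = 1 := by
      rw [modeStd_mul_self, mul_one_div_cancel (abs_pos.2 (eigenval_ne_zero h0 hL k)).ne']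
    rw [coordEquiv_symm_apply, ← Complex.normSq_eq_norm_sq, Complex.normSq_mk]
    linear_combination (g k ^ 2 / 2 + g (negMode k) ^ 2 / 2) * h1
  rw [quadForm, Finset.sum_congr rfl fun k _ => h k, Finset.sum_add_distrib,
    sum_negMode (fun k => g k ^ 2 / 2)]
  ring

/-- Lebesgue measure in the coordinates `coordEquiv`, up to a constant. -/
theorem exists_lebesgue_eq_smul_map {L : ℝ} (h0 : 0 < L) (hL : L < 2 * Real.pi) (N : ℕ) :
    ∃ c : NNReal, lebesgue N
      = c • Measure.map (coordEquiv h0 hL N).symm.toContinuousLinearEquiv volume :=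
  ⟨_, Measure.isAddLeftInvariant_eq_smul _ _⟩

theorem gaussE_eq_integral_exp {ι : Type*} [Fintype ι] (p : MvPolynomial ι ℝ) :
    Integrable (fun g : ι → ℝ => Real.exp (-∑ k, g k ^ 2 / 2) * MvPolynomial.eval g p) ∧
    ∫ g : ι → ℝ, Real.exp (-∑ k, g k ^ 2 / 2) * MvPolynomial.eval g p
      = gaussE ι p * ∫ g : ι → ℝ, Real.exp (-∑ k, g k ^ 2 / 2) := by
  have hZ : ∫ g : ι → ℝ, Real.exp (-∑ k, g k ^ 2 / 2)
      = ∏ _k : ι, ∫ x : ℝ, Real.exp (-(x ^ 2 / 2)) := by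
    rw [← integral_fintype_prod_volume_eq_prod]
    simp only [← Real.exp_sum, Finset.sum_neg_distrib]
  induction p using MvPolynomial.induction_on' with
  | add p q hp hq =>
    simp only [map_add, mul_add, add_mul]
    exact ⟨hp.1.add hq.1, by rw [integral_add hp.1 hq.1, hp.2, hq.2]⟩
  | monomial α c =>
    have h : ∀ g : ι → ℝ, Real.exp (-∑ k, g k ^ 2 / 2) *
        MvPolynomial.eval g (MvPolynomial.monomial α c)
        = c * ∏ k, (g k ^ α k * Real.exp (-(g k ^ 2 / 2))) := fun g => by
      rw [MvPolynomial.eval_monomial, Finset.prod_mul_distrib, ← Real.exp_sum,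
        Finset.sum_neg_distrib, Finsupp.prod_fintype _ _ fun _ => pow_zero _]
      ring
    simp only [h]
    refine ⟨(Integrable.fintype_prod fun k => integrable_pow_mul_exp (α k)).const_mul c, ?_⟩
    rw [integral_const_mul, integral_fintype_prod_volume_eq_prod (fun k (x : ℝ) =>
      x ^ α k * Real.exp (-(x ^ 2 / 2))), hZ, gaussE_monomial]
    simp only [integral_pow_mul_exp, Finset.prod_mul_distrib]
    ring

/-- Expectations under the Gaussian field of polynomials in the coordinates `coordEquiv`. -/
theorem integral_eval_gaussianField {L : ℝ} (h0 : 0 < L) (hL : L < 2 * Real.pi) {N : ℕ}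
    (p : MvPolynomial (modes N) ℝ) :
    Integrable (fun y => MvPolynomial.eval (coordEquiv h0 hL N y) p) (gaussianField L N) ∧
    ∫ y, MvPolynomial.eval (coordEquiv h0 hL N y) p ∂(gaussianField L N) = gaussE (modes N) p := by
  have := isProbabilityMeasure_gaussianField h0 hL N
  obtain ⟨c, hc⟩ := exists_lebesgue_eq_smul_map h0 hL N
  let T := (coordEquiv h0 hL N).symm.toContinuousLinearEquiv
  have hT : MeasurableEmbedding T := T.toHomeomorph.measurableEmbedding
  have hq : ∀ g, quadForm L (T g) = ∑ k, g k ^ 2 / 2 := quadForm_coordEquiv_symm h0 hL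
  have hTi : ∀ g, coordEquiv h0 hL N (T g) = g := (coordEquiv h0 hL N).apply_symm_apply
  have hint : ∀ f : coeffSpace N → ℝ,
      ∫ y, f y ∂(lebesgue N) = c * ∫ g, f (T g) := fun f => by
    rw [hc, integral_smul_nnreal_measure, hT.integral_map]
    rfl
  have hexp : Integrable (fun y => Real.exp (-quadForm L y)) (lebesgue N) := by
    by_contra h
    have h2 : gaussianField L N = 0 := tilted_of_not_integrable h
    exact IsProbabilityMeasure.ne_zero _ h2
  have hpos : 0 < ∫ y, Real.exp (-quadForm L y) ∂(lebesgue N) := integral_exp_pos hexp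
  have hZ : ∫ y, Real.exp (-quadForm L y) ∂(lebesgue N)
      = c * ∫ g : modes N → ℝ, Real.exp (-∑ k, g k ^ 2 / 2) := by
    rw [hint]
    simp only [hq]
  obtain ⟨h1, h2⟩ := gaussE_eq_integral_exp p
  constructor
  · rw [gaussianField, integrable_tilted_iff hexp, hc]
    refine Integrable.smul_measure_nnreal ?_
    rw [hT.integrable_map_iff]
    refine h1.congr (Filter.Eventually.of_forall fun g => ?_)
    simp only [Function.comp_apply, smul_eq_mul]
    rw [hq, hTi]
  · rw [gaussianField, integral_tilted]
    have h3 : ∀ y, (Real.exp (-quadForm L y) / ∫ y, Real.exp (-quadForm L y) ∂(lebesgue N)) •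
        MvPolynomial.eval (coordEquiv h0 hL N y) p
        = (∫ y, Real.exp (-quadForm L y) ∂(lebesgue N))⁻¹ *
          (Real.exp (-quadForm L y) * MvPolynomial.eval (coordEquiv h0 hL N y) p) := fun y => by
      rw [smul_eq_mul]
      ring
    simp only [h3]
    rw [integral_const_mul, inv_mul_eq_iff_eq_mul₀ hpos.ne', hint, hZ]
    simp only [hq, hTi]
    rw [h2]
    ring

/-! ### Integrating polynomials that depend on a parameter -/

section PolyIntegral

open MvPolynomial

variable {ι X : Type*}

section Degree

variable [Fintype ι] [MeasurableSpace X] (μ : Measure X)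

/-- The coefficientwise integral of a family of polynomials of degree at most `d`. -/
def polyIntegral (d : ℕ) (F : X → MvPolynomial ι ℝ) : MvPolynomial ι ℝ :=
  ∑ α ∈ (Finsupp.finite_of_degree_le (σ := ι) d).toFinset, monomial α (∫ x, coeff α (F x) ∂μ)

theorem totalDegree_polyIntegral_le (d : ℕ) (F : X → MvPolynomial ι ℝ) :
    (polyIntegral μ d F).totalDegree ≤ d := by
  refine totalDegree_finsetSum_le fun α hα => ?_
  rw [Set.Finite.mem_toFinset] at hα
  exact (totalDegree_monomial_le _ _).trans hα

end Degree

variable [TopologicalSpace X]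

/-- A family of polynomials whose coefficients depend continuously on the parameter. -/
def ContCoeff (F : X → MvPolynomial ι ℝ) : Prop := ∀ α, Continuous fun x => coeff α (F x)

theorem ContCoeff.add {F G : X → MvPolynomial ι ℝ} (hF : ContCoeff F) (hG : ContCoeff G) :
    ContCoeff fun x => F x + G x := fun α => by
  simp only [coeff_add]
  exact (hF α).add (hG α)

theorem ContCoeff.sub {F G : X → MvPolynomial ι ℝ} (hF : ContCoeff F) (hG : ContCoeff G) :
    ContCoeff fun x => F x - G x := fun α => by
  simp only [coeff_sub]
  exact (hF α).sub (hG α)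

theorem ContCoeff.mul {F G : X → MvPolynomial ι ℝ} (hF : ContCoeff F) (hG : ContCoeff G) :
    ContCoeff fun x => F x * G x := fun α => by
  classical
  simp only [coeff_mul]
  exact continuous_finsetSum _ fun β _ => (hF β.1).mul (hG β.2)

theorem contCoeff_const (p : MvPolynomial ι ℝ) : ContCoeff fun _ : X => p :=
  fun _ => continuous_const

theorem ContCoeff.pow {F : X → MvPolynomial ι ℝ} (hF : ContCoeff F) (n : ℕ) :
    ContCoeff fun x => F x ^ n := by
  induction n with
  | zero => simpa using contCoeff_const 1
  | succ n ih =>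
    simp only [pow_succ]
    exact ih.mul hF

variable [Fintype ι]

theorem contCoeff_linForm {a : X → ι → ℝ} (ha : Continuous a) :
    ContCoeff fun x => linForm (a x) := fun α => by
  simp only [linForm, coeff_sum, coeff_C_mul]
  fun_prop

theorem contCoeff_hermitePoly_four {a : X → ι → ℝ} (ha : Continuous a) (c : ℝ) :
    ContCoeff fun x => Polynomial.aeval (linForm (a x)) (hermitePoly c 4) := by
  simp only [hermitePoly_four, map_add, map_sub, map_mul, map_pow, Polynomial.aeval_X,
    Polynomial.aeval_C]
  have h := contCoeff_linForm ha
  exact ((h.pow 4).sub ((contCoeff_const _).mul (h.pow 2))).add (contCoeff_const _)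

theorem totalDegree_hermitePoly_four_le (a : ι → ℝ) (c : ℝ) :
    (Polynomial.aeval (linForm a) (hermitePoly c 4)).totalDegree ≤ 4 := by
  have h : ∀ n, (linForm a ^ n).totalDegree ≤ n := fun n =>
    (totalDegree_pow _ _).trans
      ((Nat.mul_le_mul_left _ (totalDegree_linForm_le a)).trans (mul_one n).le)
  simp only [hermitePoly_four, map_add, map_sub, map_mul, map_pow, Polynomial.aeval_X,
    Polynomial.aeval_C, algebraMap_eq]
  rw [← map_pow, ← map_mul, ← map_mul]
  refine (totalDegree_add _ _).trans (max_le ((totalDegree_sub _ _).trans (max_le (h 4) ?_)) ?_)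
  · refine (totalDegree_mul _ _).trans ?_
    have := h 2
    simp only [totalDegree_C]
    omega
  · simp only [totalDegree_C]
    omega

variable [CompactSpace X] [MeasurableSpace X] [OpensMeasurableSpace X]
  (μ : Measure X) [IsFiniteMeasure μ]

theorem integrable_of_continuous {E : Type*} [NormedAddCommGroup E]
    [SecondCountableTopologyEither X E] {f : X → E} (hf : Continuous f) : Integrable f μ := by
  obtain ⟨C, hC⟩ := (isCompact_range hf).isBounded.exists_norm_le
  exact Integrable.of_bound hf.aestronglyMeasurable C
    (Filter.Eventually.of_forall fun x => hC _ ⟨x, rfl⟩)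

theorem eq_sum_monomial_of_totalDegree_le {d : ℕ} {p : MvPolynomial ι ℝ} (hp : p.totalDegree ≤ d) :
    p = ∑ α ∈ (Finsupp.finite_of_degree_le (σ := ι) d).toFinset, monomial α (coeff α p) := by
  conv_lhs => rw [p.as_sum]
  refine Finset.sum_subset (fun α hα => ?_) fun α _ h => ?_
  · rw [Set.Finite.mem_toFinset]
    exact (le_totalDegree hα).trans hp
  · rw [notMem_support_iff.1 h, monomial_zero]

theorem linearMap_eq_sum_of_totalDegree_le (Λ : MvPolynomial ι ℝ →ₗ[ℝ] ℝ) {d : ℕ}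
    {p : MvPolynomial ι ℝ} (hp : p.totalDegree ≤ d) :
    Λ p = ∑ α ∈ (Finsupp.finite_of_degree_le (σ := ι) d).toFinset,
      coeff α p * Λ (monomial α 1) := by
  conv_lhs => rw [eq_sum_monomial_of_totalDegree_le hp]
  rw [map_sum]
  refine Finset.sum_congr rfl fun α _ => ?_
  rw [← smul_eq_mul, ← map_smul, smul_monomial, smul_eq_mul, mul_one]

/-- The coefficientwise integral commutes with every linear functional. -/
theorem linearMap_polyIntegral (Λ : MvPolynomial ι ℝ →ₗ[ℝ] ℝ) {d : ℕ}
    {F : X → MvPolynomial ι ℝ} (hF : ContCoeff F) (hd : ∀ x, (F x).totalDegree ≤ d) :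
    Λ (polyIntegral μ d F) = ∫ x, Λ (F x) ∂μ := by
  simp only [fun x => linearMap_eq_sum_of_totalDegree_le Λ (hd x)]
  rw [integral_finsetSum _ fun α _ => (integrable_of_continuous μ (hF α)).mul_const _,
    polyIntegral, map_sum]
  refine Finset.sum_congr rfl fun α _ => ?_
  rw [integral_mul_const, ← smul_eq_mul, ← map_smul, smul_monomial, smul_eq_mul, mul_one]

theorem gaussE_polyIntegral_sq {d : ℕ} {F : X → MvPolynomial ι ℝ} (hF : ContCoeff F)
    (hd : ∀ x, (F x).totalDegree ≤ d) : gaussE ι (polyIntegral μ d F ^ 2)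
      = ∫ x, ∫ x', gaussE ι (F x * F x') ∂μ ∂μ := by
  have h1 : ∀ q, gaussE ι (polyIntegral μ d F * q) = ∫ x, gaussE ι (F x * q) ∂μ := fun q => by
    have := linearMap_polyIntegral μ ((gaussE ι).comp (LinearMap.mulRight ℝ q)) hF hd
    simpa using this
  rw [sq, h1]
  congr 1 with x
  rw [mul_comm, h1]
  simp only [mul_comm]

end PolyIntegral

/-! ### The truncated fields and the variance of the renormalised quartic -/

section TruncatedField

open MvPolynomial

theorem continuous_basisFun (L : ℝ) (k : ℤ × ℤ) : Continuous (basisFun L k) := by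
  unfold basisFun
  fun_prop

theorem basisFun_neg (L : ℝ) (k : ℤ × ℤ) (x : Torus L) :
    basisFun L (-k) x = starRingEnd ℂ (basisFun L k x) := by
  simp [basisFun]

/-- The coefficient of the coordinate `g_k` in the field with modes `|k| ≤ M` at `x`. -/
def modeCoef (L : ℝ) {N : ℕ} (M : ℕ) (x : Torus L) (k : modes N) : ℝ :=
  if k.1 ∈ modes M then modeStd L k * ((basisFun L k x).re - (basisFun L k x).im) else 0

theorem continuous_modeCoef (L : ℝ) (N M : ℕ) : Continuous (modeCoef L (N := N) M) := by
  refine continuous_pi fun k => ?_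
  unfold modeCoef
  have := continuous_basisFun L k
  split_ifs <;> fun_prop

theorem neg_mem_modes_iff {M : ℕ} {k : ℤ × ℤ} : -k ∈ modes M ↔ k ∈ modes M :=
  ⟨fun h => by simpa using neg_mem_modes h, neg_mem_modes⟩

theorem sum_eq_zero_of_negMode {N : ℕ} {E : Type*} [AddCommGroup E] [IsAddTorsionFree E]
    {f : modes N → E} (hf : ∀ k, f (negMode k) = -f k) : ∑ k, f k = 0 := by
  have h := sum_negMode f
  simp only [hf, Finset.sum_neg_distrib] at h
  exact self_eq_neg.1 h.symm

/-- The two expansions of the field differ by a sum that is odd under `k ↦ -k`. -/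
theorem field_eq_sum {L : ℝ} (h0 : 0 < L) (hL : L < 2 * Real.pi) {N : ℕ} (y : coeffSpace N)
    (x : Torus L) : field L y x = ∑ k, modeCoef L N x k * coordEquiv h0 hL N y k := by
  obtain ⟨g, rfl⟩ := (coordEquiv h0 hL N).symm.surjective y
  rw [LinearEquiv.apply_symm_apply, field, fieldC, Complex.re_sum, ← sub_eq_zero,
    ← Finset.sum_sub_distrib]
  refine sum_eq_zero_of_negMode fun k => ?_
  have h1 : basisFun L (negMode k) x = starRingEnd ℂ (basisFun L k x) := basisFun_neg L k x
  have h2 : modeStd L (negMode k) = modeStd L k := modeStd_neg L k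
  simp only [coordEquiv_symm_apply, modeCoef, if_pos k.2, if_pos (negMode k).2, h1, h2,
    negMode_negMode, Complex.mul_re, Complex.conj_re, Complex.conj_im]
  ring

/-- The variance `|λ_k|⁻¹` of the mode `k`, or zero if `k` is truncated. -/
def modeVar (L : ℝ) {N : ℕ} (M : ℕ) (k : modes N) : ℝ :=
  if k.1 ∈ modes M then 1 / |eigenval L k| else 0

/-- The covariance of two truncated fields is that of the smaller one. The real and the complex form
of the sum differ by terms that are odd under `k ↦ -k`. -/
theorem sum_modeCoef_mul (L : ℝ) {N M M' : ℕ} (h : modes M ∩ modes N ⊆ modes M') (x x' : Torus L) :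
    ((∑ k : modes N, modeCoef L M x k * modeCoef L M' x' k : ℝ) : ℂ)
      = ∑ k : modes N, (modeVar L M k : ℂ)
        * (basisFun L k x * starRingEnd ℂ (basisFun L k x')) := by
  rw [Complex.ofReal_sum, ← sub_eq_zero, ← Finset.sum_sub_distrib]
  refine sum_eq_zero_of_negMode fun k => ?_
  have h1 : ∀ x, basisFun L (negMode k) x = starRingEnd ℂ (basisFun L k x) := basisFun_neg L k
  have h2 : modeStd L (negMode k) = modeStd L k := modeStd_neg L k
  have h3 : eigenval L (negMode k) = eigenval L k := eigenval_neg L k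
  have h4 : ∀ M, ((negMode k).1 ∈ modes M) = (k.1 ∈ modes M) := fun M => propext neg_mem_modes_iff
  simp only [modeCoef, modeVar, h1, h2, h3, h4]
  by_cases hM : k.1 ∈ modes M
  · have hM' : k.1 ∈ modes M' := h (Finset.mem_inter.2 ⟨hM, k.2⟩)
    simp only [hM, hM', if_true, ← modeStd_mul_self]
    apply Complex.ext
    · simp
      ring
    · simp
      ring
  · simp [hM]

/-- The variance at a point of the field with modes `|k| ≤ M`, out of the modes `|k| ≤ N`. -/
def truncConst (L : ℝ) (N M : ℕ) : ℝ := 1 / L ^ 2 * ∑ k : modes N, modeVar L M k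

theorem norm_basisFun {L : ℝ} (h0 : 0 < L) (k : ℤ × ℤ) (x : Torus L) :
    ‖basisFun L k x‖ = L⁻¹ := by
  simp [basisFun, fourier_apply, abs_of_pos h0, Circle.norm_coe]

theorem sum_modeCoef_mul_self {L : ℝ} (h0 : 0 < L) (N M : ℕ) (x : Torus L) :
    ∑ k : modes N, modeCoef L M x k * modeCoef L M x k = truncConst L N M := by
  apply Complex.ofReal_injective
  rw [sum_modeCoef_mul L Finset.inter_subset_left, truncConst]
  simp only [Complex.mul_conj, Complex.normSq_eq_norm_sq, norm_basisFun h0]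
  push_cast
  rw [Finset.mul_sum]
  refine Finset.sum_congr rfl fun k _ => ?_
  field_simp

theorem truncConst_self (L : ℝ) (N : ℕ) : truncConst L N N = renormConst L N := by
  rw [truncConst, renormConst, ← Finset.sum_coe_sort (modes N)]
  simp [modeVar]

theorem continuous_hermite (L : ℝ) (N M : ℕ) (g : modes N → ℝ) (c : ℝ) :
    Continuous fun x : Torus L => H 4 (∑ k, modeCoef L M x k * g k) c := by
  have h : ∀ k, Continuous fun x : Torus L => modeCoef L M x k := fun k =>
    (continuous_apply k).comp (continuous_modeCoef L N M)
  simp only [H_four]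
  fun_prop

/-- The Wick power `:φ⁴:` of the field with modes `|k| ≤ M`, as a polynomial in the coordinates. -/
def wickPoly (L : ℝ) (N M : ℕ) (x : Torus L) : MvPolynomial (modes N) ℝ :=
  Polynomial.aeval (linForm (modeCoef L M x)) (hermitePoly (truncConst L N M) 4)

theorem eval_wickPoly {L : ℝ} (N M : ℕ) (x : Torus L) (g : modes N → ℝ) :
    eval g (wickPoly L N M x) = H 4 (∑ k, modeCoef L M x k * g k) (truncConst L N M) := by
  have h : eval g (linForm (modeCoef L M x)) = ∑ k, modeCoef L M x k * g k := by
    simp [linForm]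
  simp [wickPoly, hermitePoly_four, H_four, h]

theorem contCoeff_wickPoly_sub {L : ℝ} (N M : ℕ) :
    ContCoeff fun x => wickPoly L N N x - wickPoly L N M x :=
  (contCoeff_hermitePoly_four (continuous_modeCoef L N N) _).sub
    (contCoeff_hermitePoly_four (continuous_modeCoef L N M) _)

theorem totalDegree_wickPoly_sub_le {L : ℝ} (N M : ℕ) (x : Torus L) :
    (wickPoly L N N x - wickPoly L N M x).totalDegree ≤ 4 :=
  (totalDegree_sub _ _).trans
    (max_le (totalDegree_hermitePoly_four_le _ _) (totalDegree_hermitePoly_four_le _ _))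

section Torus

variable (L : ℝ) [hL0 : Fact (0 < L)]

theorem volume_torus : (volume : Measure (Torus L)).real Set.univ = L ^ 2 := by
  rw [Measure.real, Measure.volume_eq_prod, ← Set.univ_prod_univ, Measure.prod_prod,
    AddCircle.measure_univ, ENNReal.toReal_mul, ENNReal.toReal_ofReal hL0.out.le, sq]

/-- The renormalised quartic of the field with modes `|k| ≤ M`, in the coordinates `g`. -/
def truncQuartic {N : ℕ} (M : ℕ) (g : modes N → ℝ) : ℝ :=
  1 / 4 * ∫ x : Torus L, H 4 (∑ k, modeCoef L M x k * g k) (truncConst L N M)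

variable {L}

theorem truncQuartic_coordEquiv (hL : L < 2 * Real.pi) {N : ℕ} (y : coeffSpace N) :
    truncQuartic L N (coordEquiv hL0.out hL N y) = wickQuartic L y := by
  rw [truncQuartic, wickQuartic, truncConst_self]
  simp only [field_eq_sum hL0.out hL]

variable (L) in
/-- Completing the square, `H₄(X, C) = (X² - 3C)² - 6C²`. -/
theorem le_truncQuartic (N M : ℕ) (g : modes N → ℝ) :
    -(3 / 2 * L ^ 2 * truncConst L N M ^ 2) ≤ truncQuartic L M g := by
  have h : ∫ _ : Torus L, -(6 * truncConst L N M ^ 2)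
      ≤ ∫ x : Torus L, H 4 (∑ k, modeCoef L M x k * g k) (truncConst L N M) := by
    refine integral_mono (integrable_const _)
      (integrable_of_continuous _ (continuous_hermite L N M g _)) fun x => ?_
    simp only [H_four]
    nlinarith [sq_nonneg ((∑ k, modeCoef L M x k * g k) ^ 2 - 3 * truncConst L N M)]
  rw [integral_const, volume_torus, smul_eq_mul] at h
  rw [truncQuartic]
  linarith

variable (L) in
/-- The difference of the renormalised quartics of the full field and of the field with modes
`|k| ≤ M`, as a polynomial in the coordinates. -/
def diffPoly (N M : ℕ) : MvPolynomial (modes N) ℝ :=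
  (1 / 4 : ℝ) • polyIntegral (volume : Measure (Torus L)) 4
    fun x => wickPoly L N N x - wickPoly L N M x

theorem totalDegree_diffPoly_le (N M : ℕ) : (diffPoly L N M).totalDegree ≤ 4 :=
  (totalDegree_smul_le _ _).trans (totalDegree_polyIntegral_le _ _ _)

theorem eval_diffPoly (N M : ℕ) (g : modes N → ℝ) :
    eval g (diffPoly L N M) = truncQuartic L N g - truncQuartic L M g := by
  have h := linearMap_polyIntegral (volume : Measure (Torus L)) (aeval (R := ℝ) g).toLinearMap
    (contCoeff_wickPoly_sub N M) (totalDegree_wickPoly_sub_le N M)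
  simp only [AlgHom.toLinearMap_apply, map_sub, aeval_eq_eval] at h
  rw [diffPoly, smul_eval, h]
  simp only [eval_wickPoly]
  rw [integral_sub (integrable_of_continuous _ (continuous_hermite L N N g _))
    (integrable_of_continuous _ (continuous_hermite L N M g _)), truncQuartic, truncQuartic]
  ring

theorem gaussE_wickPoly_mul {N M M' : ℕ} (x x' : Torus L) :
    gaussE (modes N) (wickPoly L N M x * wickPoly L N M' x')
      = 24 * (∑ k : modes N, modeCoef L M x k * modeCoef L M' x' k) ^ 4 := by
  rw [wickPoly, wickPoly, ← sum_modeCoef_mul_self hL0.out N M x, gaussE_hermite_four_mul]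

theorem gaussE_wickPoly_sub_mul {N M : ℕ} (x x' : Torus L) :
    gaussE (modes N) ((wickPoly L N N x - wickPoly L N M x)
      * (wickPoly L N N x' - wickPoly L N M x'))
      = 24 * ((∑ k : modes N, modeCoef L N x k * modeCoef L N x' k) ^ 4
        - (∑ k : modes N, modeCoef L M x k * modeCoef L M x' k) ^ 4) := by
  -- a truncated and an untruncated field have the covariance of the truncated one
  have h2 : ∀ x x' : Torus L, (∑ k : modes N, modeCoef L M x k * modeCoef L N x' k)
      = ∑ k : modes N, modeCoef L M x k * modeCoef L M x' k := fun x x' => by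
    apply Complex.ofReal_injective
    rw [sum_modeCoef_mul L Finset.inter_subset_right, sum_modeCoef_mul L Finset.inter_subset_left]
  have h1 : (∑ k : modes N, modeCoef L N x k * modeCoef L M x' k)
      = ∑ k : modes N, modeCoef L M x k * modeCoef L M x' k := by
    simpa only [mul_comm] using h2 x' x
  rw [sub_mul, mul_sub, mul_sub, map_sub, map_sub, map_sub]
  simp only [gaussE_wickPoly_mul, h1, h2]
  ring

end Torus

end TruncatedField

/-! ### Lattice sums -/

/-- The weight `max (1, |k₁|, |k₂|)` of a wave vector. -/
def bracket (k : ℤ × ℤ) : ℝ := max 1 (max |(k.1 : ℝ)| |(k.2 : ℝ)|)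

theorem one_le_bracket (k : ℤ × ℤ) : 1 ≤ bracket k := le_max_left _ _

theorem bracket_pos (k : ℤ × ℤ) : 0 < bracket k := zero_lt_one.trans_le (one_le_bracket k)

theorem bracket_le_of_mem_modes {M : ℕ} (hM : 1 ≤ M) {k : ℤ × ℤ} (hk : k ∈ modes M) :
    bracket k ≤ M := by
  simp only [modes, Finset.mem_product, Finset.mem_Icc] at hk
  refine max_le (by exact_mod_cast hM) (max_le ?_ ?_)
  · exact_mod_cast abs_le.2 hk.1
  · exact_mod_cast abs_le.2 hk.2

theorem le_bracket_of_notMem_modes {M : ℕ} {k : ℤ × ℤ} (hk : k ∉ modes M) :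
    (M : ℝ) ≤ bracket k := by
  by_contra! h
  obtain ⟨-, h⟩ := max_lt_iff.1 h
  obtain ⟨h1, h2⟩ := max_lt_iff.1 h
  refine hk (Finset.mem_product.2 ⟨Finset.mem_Icc.2 (abs_le.1 ?_), Finset.mem_Icc.2 (abs_le.1 ?_)⟩)
  · exact_mod_cast h1.le
  · exact_mod_cast h2.le

theorem summable_bracket_rpow {s : ℝ} (hs : 2 < s) : Summable fun k => bracket k ^ (-s) := by
  have h1 := (finTwoArrowEquiv ℤ).symm.summable_iff.2
    (EisensteinSeries.summable_one_div_norm_rpow hs)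
  have h2 : Summable fun k : ℤ × ℤ => if k = 0 then (1 : ℝ) else 0 :=
    summable_of_hasFiniteSupport ((Set.finite_singleton 0).subset fun k hk => by
      by_contra h
      exact hk (if_neg h))
  refine (h1.add h2).of_nonneg_of_le (fun k => (Real.rpow_pos_of_pos (bracket_pos k) _).le)
    fun k => ?_
  have hn : 0 ≤ ‖(finTwoArrowEquiv ℤ).symm k‖ ^ (-s) := Real.rpow_nonneg (norm_nonneg _) _
  simp only [Function.comp_apply]
  by_cases hk : k = 0
  · subst hk
    simpa [bracket] using hn
  · rw [if_neg hk, add_zero]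
    have h3 : bracket k = ‖(finTwoArrowEquiv ℤ).symm k‖ := by
      rw [EisensteinSeries.norm_eq_max_natAbs, bracket]
      have h4 : (1 : ℝ) ≤ max |(k.1 : ℝ)| |(k.2 : ℝ)| := by
        by_contra! h
        obtain ⟨h5, h6⟩ := max_lt_iff.1 h
        have h5 : |k.1| < 1 := by exact_mod_cast h5
        have h6 : |k.2| < 1 := by exact_mod_cast h6
        exact hk (Prod.ext (Int.abs_lt_one_iff.1 h5) (Int.abs_lt_one_iff.1 h6))
      rw [max_eq_right h4]
      simp [Nat.cast_natAbs]
    rw [h3]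

theorem sum_modes_le_tsum {f : ℤ × ℤ → ℝ} (hf : Summable f) (h0 : ∀ k, 0 ≤ f k) (N : ℕ) :
    ∑ k : modes N, f k ≤ ∑' k, f k := by
  rw [Finset.sum_coe_sort (modes N)]
  exact hf.sum_le_tsum _ fun k _ => h0 k

theorem exists_modeVar_le {L : ℝ} (h0 : 0 < L) (hL : L < 2 * Real.pi) :
    ∃ A : ℝ, 0 < A ∧ ∀ k : ℤ × ℤ, 1 / |eigenval L k| ≤ A * bracket k ^ (-2 : ℝ) := by
  have hq : 1 < (2 * Real.pi / L) ^ 2 := by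
    have : 1 < 2 * Real.pi / L := by rw [lt_div_iff₀ h0]; linarith
    nlinarith
  set q := (2 * Real.pi / L) ^ 2 with hqd
  refine ⟨max 1 (1 / (q - 1)), by positivity, fun k => ?_⟩
  rw [Real.rpow_neg (bracket_pos k).le, Real.rpow_two]
  by_cases hk : k = 0
  · subst hk
    simp [eigenval, bracket]
  · have hpos := eigenval_pos h0 hL hk
    have hb : (q - 1) * bracket k ^ 2 ≤ eigenval L k := by
      have h1 : (1 : ℝ) ≤ (k.1 : ℝ) ^ 2 + (k.2 : ℝ) ^ 2 := by
        have h2 : 0 < k.1 ^ 2 + k.2 ^ 2 := by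
          by_contra! h
          have a := sq_nonneg k.1
          have b := sq_nonneg k.2
          exact hk (Prod.ext ((pow_eq_zero_iff two_ne_zero).1 (show k.1 ^ 2 = 0 by omega))
            ((pow_eq_zero_iff two_ne_zero).1 (show k.2 ^ 2 = 0 by omega)))
        exact_mod_cast h2
      have h3 : bracket k ^ 2 ≤ (k.1 : ℝ) ^ 2 + (k.2 : ℝ) ^ 2 := by
        unfold bracket
        rcases max_choice 1 (max |(k.1 : ℝ)| |(k.2 : ℝ)|) with h | h <;> rw [h]
        · linarith
        · rcases max_choice |(k.1 : ℝ)| |(k.2 : ℝ)| with h | h <;> rw [h, sq_abs]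
          · linarith [sq_nonneg (k.2 : ℝ)]
          · linarith [sq_nonneg (k.1 : ℝ)]
      rw [eigenval, ← hqd]
      nlinarith
    have hb2 : 0 < bracket k ^ 2 := by have := bracket_pos k; positivity
    rw [abs_of_pos hpos]
    calc 1 / eigenval L k ≤ 1 / ((q - 1) * bracket k ^ 2) :=
          one_div_le_one_div_of_le (mul_pos (by linarith) hb2) hb
      _ = 1 / (q - 1) * (bracket k ^ 2)⁻¹ := by rw [one_div, one_div, mul_inv]
      _ ≤ _ := by gcongr; exact le_max_right _ _

theorem modeVar_nonneg (L : ℝ) {N : ℕ} (M : ℕ) (k : modes N) : 0 ≤ modeVar L M k := by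
  unfold modeVar
  split_ifs <;> positivity

/-- The renormalisation constants grow at most like a small power of the cutoff. The exponent `1/64`
is chosen so that their squares are of order `2 ^ i` at the cutoff `2 ^ (32 i)`. -/
theorem exists_truncConst_le {L : ℝ} (h0 : 0 < L) (hL : L < 2 * Real.pi) :
    ∃ B : ℝ, 0 < B ∧ ∀ N M : ℕ, 1 ≤ M →
      0 ≤ truncConst L N M ∧ truncConst L N M ≤ B * (M : ℝ) ^ (1 / 64 : ℝ) := by
  obtain ⟨A, hA, h⟩ := exists_modeVar_le h0 hL
  set S := ∑' k, bracket k ^ (-(2 + 1 / 64) : ℝ)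
  have hS0 : 0 ≤ S := tsum_nonneg fun k => Real.rpow_nonneg (bracket_pos k).le _
  refine ⟨1 / L ^ 2 * (A * (S + 1)), by positivity, fun N M hM => ⟨?_, ?_⟩⟩
  · exact mul_nonneg (by positivity) (Finset.sum_nonneg fun k _ => modeVar_nonneg L M k)
  · rw [truncConst, mul_assoc]
    gcongr
    calc ∑ k : modes N, modeVar L M k
        ≤ ∑ k : modes N, A * (M : ℝ) ^ (1 / 64 : ℝ) * bracket k ^ (-(2 + 1 / 64) : ℝ) := by
          refine Finset.sum_le_sum fun k _ => ?_
          unfold modeVar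
          split_ifs with hk
          · refine (h k).trans ?_
            rw [show (-2 : ℝ) = 1 / 64 + -(2 + 1 / 64) by norm_num, Real.rpow_add (bracket_pos _),
              ← mul_assoc]
            have := bracket_le_of_mem_modes hM hk
            have := bracket_pos k
            gcongr
          · have := bracket_pos k
            positivity
      _ = A * (M : ℝ) ^ (1 / 64 : ℝ) * ∑ k : modes N, bracket k ^ (-(2 + 1 / 64) : ℝ) := by
          rw [Finset.mul_sum]
      _ ≤ A * (M : ℝ) ^ (1 / 64 : ℝ) * S := by
          gcongr
          exact sum_modes_le_tsum (summable_bracket_rpow (by norm_num))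
            (fun k => Real.rpow_nonneg (bracket_pos k).le _) N
      _ ≤ A * (S + 1) * (M : ℝ) ^ (1 / 64 : ℝ) := by
          have : 0 ≤ A * (M : ℝ) ^ (1 / 64 : ℝ) := by positivity
          linarith

theorem mul_le_sum_pow_four (w x y z : ℝ) :
    w * x * y * z ≤ (w ^ 4 + x ^ 4 + y ^ 4 + z ^ 4) / 4 := by
  nlinarith [sq_nonneg (w ^ 2 - x ^ 2), sq_nonneg (y ^ 2 - z ^ 2), sq_nonneg (w * x - y * z)]

theorem sum_prod_erase_le {ι : Type*} [Fintype ι] (v : ι → ℤ × ℤ) (hv : Function.Injective v)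
    (d : ι → ℝ) (hd : ∀ k, 0 ≤ d k) (i : Fin 4) :
    ∑ p : Fin 4 → ι with ∑ j, v (p j) = 0, ∏ j : Fin 3, d (p (i.succAbove j)) ≤ (∑ k, d k) ^ 3 := by
  classical
  rw [Fintype.sum_pow]
  have hinj : Set.InjOn (fun (p : Fin 4 → ι) j => p (i.succAbove j))
      ((Finset.univ.filter fun p : Fin 4 → ι => ∑ j, v (p j) = 0 : Finset _) :
        Set (Fin 4 → ι)) := by
    intro p hp q hq h
    have hp := (Finset.mem_filter.1 hp).2
    have hq := (Finset.mem_filter.1 hq).2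
    rw [Fin.sum_univ_succAbove _ i] at hp hq
    have h1 : ∀ j, p (i.succAbove j) = q (i.succAbove j) := fun j => congrFun h j
    have h2 : p i = q i := hv (by
      simp only [h1] at hp
      exact add_right_cancel (hp.trans hq.symm))
    funext j
    rcases Fin.eq_self_or_eq_succAbove i j with rfl | ⟨j, rfl⟩
    · exact h2
    · exact h1 j
  rw [← Finset.sum_image (f := fun q : Fin 3 → ι => ∏ j, d (q j)) hinj]
  exact Finset.sum_le_sum_of_subset_of_nonneg (Finset.subset_univ _)
    fun q _ _ => Finset.prod_nonneg fun j _ => hd _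

/-- A case of Young's inequality for convolutions, from the inequality of arithmetic and geometric
means. -/
theorem sum_prod_le {ι : Type*} [Fintype ι] (v : ι → ℤ × ℤ) (hv : Function.Injective v)
    (c : ι → ℝ) : ∑ p : Fin 4 → ι with ∑ j, v (p j) = 0, ∏ j, c (p j) ^ 3 ≤ (∑ k, c k ^ 4) ^ 3 := by
  have h : ∀ p : Fin 4 → ι, ∏ j, c (p j) ^ 3
      ≤ 1 / 4 * ∑ i : Fin 4, ∏ j : Fin 3, c (p (i.succAbove j)) ^ 4 := fun p => by
    have h := mul_le_sum_pow_four (c (p 1) * c (p 2) * c (p 3)) (c (p 0) * c (p 2) * c (p 3))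
      (c (p 0) * c (p 1) * c (p 3)) (c (p 0) * c (p 1) * c (p 2))
    rw [Fin.prod_univ_four, Fin.sum_univ_four]
    simp only [Fin.prod_univ_three]
    calc _ = _ := by ring
      _ ≤ _ := h
      _ = _ := by
        have e0 : ∀ j : Fin 3, (0 : Fin 4).succAbove j = ![1, 2, 3] j := by decide
        have e1 : ∀ j : Fin 3, (1 : Fin 4).succAbove j = ![0, 2, 3] j := by decide
        have e2 : ∀ j : Fin 3, (2 : Fin 4).succAbove j = ![0, 1, 3] j := by decide
        have e3 : ∀ j : Fin 3, (3 : Fin 4).succAbove j = ![0, 1, 2] j := by decide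
        simp only [e0, e1, e2, e3]
        simp
        ring
  refine (Finset.sum_le_sum fun p _ => h p).trans ?_
  rw [← Finset.mul_sum, Finset.sum_comm]
  have h2 := Finset.sum_le_sum fun i (_ : i ∈ (Finset.univ : Finset (Fin 4))) =>
    sum_prod_erase_le v hv (fun k => c k ^ 4) (fun k => by positivity) i
  simp only [Finset.sum_const, Finset.card_univ, Fintype.card_fin, nsmul_eq_mul] at h2
  push_cast at h2
  linarith

/-- The fourfold lattice sum over `p₁ + p₂ + p₃ + p₄ = 0` in which at least one mode exceeds the
cutoff `M` decays like a power of `M`. Of the exponent `2` of each factor `|λ_k|⁻¹`, an amount `1/4`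
is spent on the cutoff. What is left is `7/4 = 3 * 7/12`, and the fourth powers of
`bracket ^ (-7/12)` are summable over the lattice because `7/3 > 2`. -/
theorem exists_sum_modeVar_le {L : ℝ} (h0 : 0 < L) (hL : L < 2 * Real.pi) :
    ∃ B : ℝ, 0 < B ∧ ∀ N M : ℕ, 1 ≤ M →
      ∑ p : Fin 4 → modes N with ∑ j, (p j : ℤ × ℤ) = 0,
        (∏ j, modeVar L N (p j) - ∏ j, modeVar L M (p j)) ≤ B * (M : ℝ) ^ (-(1 / 4) : ℝ) := by
  obtain ⟨A, hA, h⟩ := exists_modeVar_le h0 hL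
  set S := ∑' k, bracket k ^ (-(7 / 3) : ℝ)
  have hS0 : 0 ≤ S := tsum_nonneg fun k => Real.rpow_nonneg (bracket_pos k).le _
  refine ⟨A ^ 4 * (S ^ 3 + 1), by positivity, fun N M hM => ?_⟩
  have hM0 : (0 : ℝ) < M := by exact_mod_cast hM
  have hterm : ∀ p : Fin 4 → modes N, ∏ j, modeVar L N (p j) - ∏ j, modeVar L M (p j)
      ≤ A ^ 4 * (M : ℝ) ^ (-(1 / 4) : ℝ) * ∏ j, (bracket (p j) ^ (-(7 / 12) : ℝ)) ^ 3 := by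
    intro p
    have hrhs : 0 ≤ A ^ 4 * (M : ℝ) ^ (-(1 / 4) : ℝ)
        * ∏ j, (bracket (p j) ^ (-(7 / 12) : ℝ)) ^ 3 :=
      mul_nonneg (by positivity) (Finset.prod_nonneg fun j _ => by
        have := bracket_pos (p j)
        positivity)
    by_cases hp : ∀ j, (p j).1 ∈ modes M
    · have : ∀ j, modeVar L M (p j) = modeVar L N (p j) := fun j => by
        simp [modeVar, hp j]
      simpa [this] using hrhs
    · push Not at hp
      obtain ⟨i, hi⟩ := hp
      have hMi : (M : ℝ) ≤ ∏ j, bracket (p j) := by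
        refine (le_bracket_of_notMem_modes hi).trans ?_
        rw [Fin.prod_univ_succAbove _ i]
        refine le_mul_of_one_le_right (bracket_pos _).le ?_
        rw [← Finset.prod_const_one (s := (Finset.univ : Finset (Fin 3)))]
        exact Finset.prod_le_prod (fun _ _ => zero_le_one) fun j _ => one_le_bracket _
      calc ∏ j, modeVar L N (p j) - ∏ j, modeVar L M (p j)
          ≤ ∏ j, modeVar L N (p j) :=
            sub_le_self _ (Finset.prod_nonneg fun j _ => modeVar_nonneg L M (p j))
        _ ≤ ∏ j, A * bracket (p j) ^ (-2 : ℝ) := by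
            refine Finset.prod_le_prod (fun j _ => modeVar_nonneg L N (p j)) fun j _ => ?_
            rw [modeVar, if_pos (p j).2]
            exact h _
        _ = A ^ 4 * ((∏ j, bracket (p j)) ^ (-(1 / 4) : ℝ)
              * ∏ j, (bracket (p j) ^ (-(7 / 12) : ℝ)) ^ 3) := by
            rw [← Real.finsetProd_rpow _ _ fun j _ => (bracket_pos (p j)).le,
              ← Finset.prod_mul_distrib, Finset.prod_mul_distrib, Finset.prod_const]
            congr 1
            refine Finset.prod_congr rfl fun j _ => ?_
            rw [← Real.rpow_natCast, ← Real.rpow_mul (bracket_pos _).le,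
              ← Real.rpow_add (bracket_pos _)]
            norm_num
        _ ≤ A ^ 4 * ((M : ℝ) ^ (-(1 / 4) : ℝ)
              * ∏ j, (bracket (p j) ^ (-(7 / 12) : ℝ)) ^ 3) := by
            have : 0 ≤ ∏ j, (bracket (p j) ^ (-(7 / 12) : ℝ)) ^ 3 :=
              Finset.prod_nonneg fun j _ => by
                have := bracket_pos (p j)
                positivity
            exact mul_le_mul_of_nonneg_left (mul_le_mul_of_nonneg_right
              (Real.rpow_le_rpow_of_nonpos hM0 hMi (by norm_num)) this) (by positivity)
        _ = _ := by ring
  refine (Finset.sum_le_sum fun p _ => hterm p).trans ?_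
  rw [← Finset.mul_sum]
  have h1 := sum_prod_le (fun k : modes N => (k : ℤ × ℤ)) Subtype.val_injective
    fun k => bracket k ^ (-(7 / 12) : ℝ)
  have h2 : ∑ k : modes N, (bracket k ^ (-(7 / 12) : ℝ)) ^ 4 ≤ S := by
    have h3 : ∀ k : modes N, (bracket k ^ (-(7 / 12) : ℝ)) ^ 4 = bracket k ^ (-(7 / 3) : ℝ) :=
      fun k => by
        rw [← Real.rpow_natCast, ← Real.rpow_mul (bracket_pos _).le]
        norm_num
    simp only [h3]
    exact sum_modes_le_tsum (summable_bracket_rpow (by norm_num))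
      (fun k => Real.rpow_nonneg (bracket_pos k).le _) N
  have h4 : (∑ k : modes N, (bracket k ^ (-(7 / 12) : ℝ)) ^ 4) ^ 3 ≤ S ^ 3 :=
    pow_le_pow_left₀ (Finset.sum_nonneg fun k _ => by
      have := bracket_pos k
      positivity) h2 3
  calc _ ≤ A ^ 4 * (M : ℝ) ^ (-(1 / 4) : ℝ) * (S ^ 3 + 1) := by
        gcongr
        linarith
    _ = _ := by ring

/-! ### The variance of the truncation error -/

/-- The product of four basis functions. -/
def basisProd (L : ℝ) {N : ℕ} (p : Fin 4 → modes N) (x : Torus L) : ℂ := ∏ j, basisFun L (p j) x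

theorem continuous_basisProd (L : ℝ) {N : ℕ} (p : Fin 4 → modes N) :
    Continuous (basisProd L p) :=
  continuous_finsetProd _ fun j _ => continuous_basisFun L (p j)

theorem modeCoef_covariance_pow_four (L : ℝ) (N M : ℕ) (x x' : Torus L) :
    (((∑ k : modes N, modeCoef L M x k * modeCoef L M x' k) ^ 4 : ℝ) : ℂ)
      = ∑ p : Fin 4 → modes N, ((∏ j, modeVar L M (p j) : ℝ) : ℂ)
        * (basisProd L p x * starRingEnd ℂ (basisProd L p x')) := by
  rw [Complex.ofReal_pow, sum_modeCoef_mul L Finset.inter_subset_left, Fintype.sum_pow]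
  refine Finset.sum_congr rfl fun p _ => ?_
  rw [Finset.prod_mul_distrib, Finset.prod_mul_distrib, basisProd, basisProd, map_prod]
  push_cast
  rfl

theorem basisProd_eq {L : ℝ} {N : ℕ} (p : Fin 4 → modes N) (x : Torus L) :
    basisProd L p x = (L : ℂ)⁻¹ ^ 4 * (fourier (∑ j, (p j : ℤ × ℤ)).1 x.1
      * fourier (∑ j, (p j : ℤ × ℤ)).2 x.2) := by
  simp only [basisProd, basisFun, Fin.prod_univ_four, Fin.sum_univ_four, Prod.fst_add,
    Prod.snd_add, fourier_add]
  ring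

theorem modeVar_le (L : ℝ) (N M : ℕ) (k : modes N) : modeVar L M k ≤ modeVar L N k := by
  rw [modeVar, modeVar, if_pos k.2]
  split_ifs
  · exact le_rfl
  · positivity

section Torus

variable {L : ℝ} [hL0 : Fact (0 < L)]

theorem integral_fourier_eq_zero {n : ℤ} (hn : n ≠ 0) : ∫ x : AddCircle L, fourier n x = 0 :=
  integral_eq_zero_of_add_right_eq_neg (fourier_add_half_inv_index hn hL0.out)

theorem integral_basisProd_eq_zero {N : ℕ} {p : Fin 4 → modes N}
    (hp : ∑ j, (p j : ℤ × ℤ) ≠ 0) : ∫ x, basisProd L p x = 0 := by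
  simp only [basisProd_eq]
  rw [integral_const_mul, Measure.volume_eq_prod, integral_prod_mul
    (fun x : AddCircle L => (fourier (∑ j, (p j : ℤ × ℤ)).1 x : ℂ))
    (fun x : AddCircle L => (fourier (∑ j, (p j : ℤ × ℤ)).2 x : ℂ))]
  by_cases h1 : (∑ j, (p j : ℤ × ℤ)).1 = 0
  · have h2 : (∑ j, (p j : ℤ × ℤ)).2 ≠ 0 := fun h2 => hp (Prod.ext h1 h2)
    rw [integral_fourier_eq_zero h2, mul_zero, mul_zero]
  · rw [integral_fourier_eq_zero h1, zero_mul, mul_zero]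

theorem norm_integral_basisProd_le {N : ℕ} (p : Fin 4 → modes N) :
    ‖∫ x, basisProd L p x‖ ≤ L⁻¹ ^ 4 * L ^ 2 := by
  rw [← volume_torus L]
  refine norm_integral_le_of_norm_le_const (Filter.Eventually.of_forall fun x => ?_)
  rw [basisProd, norm_prod]
  simp [norm_basisFun hL0.out]

theorem integral_integral_basisProd {N : ℕ} (A : (Fin 4 → modes N) → ℝ)
    (h : Torus L → Torus L → ℝ) (hh : ∀ x x', (h x x' : ℂ)
      = ∑ p, (A p : ℂ) * (basisProd L p x * starRingEnd ℂ (basisProd L p x'))) :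
    ∫ x, ∫ x', h x x' = ∑ p, A p * ‖∫ x, basisProd L p x‖ ^ 2 := by
  have hc : ∀ p : Fin 4 → modes N, Integrable (basisProd L p) := fun p =>
    integrable_of_continuous _ (continuous_basisProd L p)
  have hc' : ∀ p : Fin 4 → modes N, Integrable fun x => starRingEnd ℂ (basisProd L p x) :=
    fun p => integrable_of_continuous _ (Complex.continuous_conj.comp (continuous_basisProd L p))
  apply Complex.ofReal_injective
  rw [← integral_complex_ofReal]
  have h1 : ∀ x, ((∫ x', h x x' : ℝ) : ℂ) = ∑ p, (A p : ℂ)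
      * (basisProd L p x * starRingEnd ℂ (∫ x', basisProd L p x')) := fun x => by
    rw [← integral_complex_ofReal]
    simp only [hh]
    rw [integral_finsetSum _ fun p _ => ((hc' p).const_mul _).const_mul _]
    simp only [integral_const_mul, integral_conj]
  simp only [h1]
  rw [integral_finsetSum _ fun p _ => ((hc p).mul_const _).const_mul _]
  simp only [integral_const_mul, integral_mul_const, Complex.mul_conj, Complex.normSq_eq_norm_sq]
  push_cast
  rfl

theorem gaussE_diffPoly_sq (N M : ℕ) : gaussE (modes N) (diffPoly L N M ^ 2)
    = 3 / 2 * ∑ p : Fin 4 → modes N, (∏ j, modeVar L N (p j) - ∏ j, modeVar L M (p j))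
      * ‖∫ x, basisProd L p x‖ ^ 2 := by
  rw [diffPoly, smul_pow, map_smul,
    gaussE_polyIntegral_sq _ (contCoeff_wickPoly_sub N M) (totalDegree_wickPoly_sub_le N M)]
  simp only [gaussE_wickPoly_sub_mul, integral_const_mul]
  rw [integral_integral_basisProd
    (fun p => ∏ j, modeVar L N (p j) - ∏ j, modeVar L M (p j)), smul_eq_mul]
  · ring
  · intro x x'
    rw [Complex.ofReal_sub, modeCoef_covariance_pow_four, modeCoef_covariance_pow_four,
      ← Finset.sum_sub_distrib]
    refine Finset.sum_congr rfl fun p _ => ?_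
    rw [← sub_mul, Complex.ofReal_sub]

/-- The mean square of the truncation error decays like a power of the cutoff `M`, uniformly in
`N`. -/
theorem exists_gaussE_diffPoly_sq_le (hL : L < 2 * Real.pi) :
    ∃ B : ℝ, 0 < B ∧ ∀ N M : ℕ, 1 ≤ M →
      gaussE (modes N) (diffPoly L N M ^ 2) ≤ B * (M : ℝ) ^ (-(1 / 4) : ℝ) := by
  obtain ⟨B, hB, h⟩ := exists_sum_modeVar_le hL0.out hL
  have hLp := hL0.out
  refine ⟨3 / 2 * (B * (L⁻¹ ^ 4 * L ^ 2) ^ 2), by positivity, fun N M hM => ?_⟩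
  rw [gaussE_diffPoly_sq, mul_assoc]
  gcongr
  calc ∑ p : Fin 4 → modes N, (∏ j, modeVar L N (p j) - ∏ j, modeVar L M (p j))
        * ‖∫ x, basisProd L p x‖ ^ 2
      = ∑ p : Fin 4 → modes N with ∑ j, (p j : ℤ × ℤ) = 0,
        (∏ j, modeVar L N (p j) - ∏ j, modeVar L M (p j)) * ‖∫ x, basisProd L p x‖ ^ 2 := by
        rw [Finset.sum_filter]
        refine Finset.sum_congr rfl fun p _ => ?_
        split_ifs with hp
        · rfl
        · rw [integral_basisProd_eq_zero hp]
          simp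
    _ ≤ ∑ p : Fin 4 → modes N with ∑ j, (p j : ℤ × ℤ) = 0,
        (∏ j, modeVar L N (p j) - ∏ j, modeVar L M (p j)) * (L⁻¹ ^ 4 * L ^ 2) ^ 2 := by
        refine Finset.sum_le_sum fun p _ => ?_
        have h1 : ∏ j, modeVar L M (p j) ≤ ∏ j, modeVar L N (p j) :=
          Finset.prod_le_prod (fun j _ => modeVar_nonneg L M _) fun j _ => modeVar_le L N M _
        exact mul_le_mul_of_nonneg_left
          (pow_le_pow_left₀ (norm_nonneg _) (norm_integral_basisProd_le p) 2) (sub_nonneg.2 h1)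
    _ ≤ _ := by
        rw [← Finset.sum_mul]
        calc _ ≤ (B * (M : ℝ) ^ (-(1 / 4) : ℝ)) * (L⁻¹ ^ 4 * L ^ 2) ^ 2 := by
              gcongr
              exact h N M hM
          _ = _ := by ring

end Torus

/-! ### Nelson's estimate -/

section Nelson

variable {L : ℝ} [hL0 : Fact (0 < L)]

theorem exists_eval_eq_truncQuartic (N M : ℕ) :
    ∃ p : MvPolynomial (modes N) ℝ, ∀ g, truncQuartic L M g = MvPolynomial.eval g p := by
  refine ⟨(1 / 4 : ℝ) • polyIntegral (volume : Measure (Torus L)) 4 (wickPoly L N M), fun g => ?_⟩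
  have h := linearMap_polyIntegral (volume : Measure (Torus L))
    (MvPolynomial.aeval (R := ℝ) g).toLinearMap
    (contCoeff_hermitePoly_four (continuous_modeCoef L N M) (truncConst L N M))
    (fun x => totalDegree_hermitePoly_four_le _ _)
  rw [MvPolynomial.smul_eval, truncQuartic]
  refine congrArg _ (Eq.trans ?_ h.symm)
  exact integral_congr_ae (Filter.Eventually.of_forall fun x => (eval_wickPoly N M x g).symm)

theorem truncQuartic_of_le {N M : ℕ} (h : N ≤ M) (g : modes N → ℝ) :
    truncQuartic L M g = truncQuartic L N g := by
  have hk : ∀ k : modes N, k.1 ∈ modes M := fun k => by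
    have hk := k.2
    simp only [modes, Finset.mem_product, Finset.mem_Icc] at hk ⊢
    omega
  simp [truncQuartic, truncConst, modeVar, modeCoef, hk]

/-- The cutoffs `2 ^ (32 i)` at which the field is truncated. They grow fast enough for the decay
`M ^ (-1/4) = 256 ^ (-i)` of the variance to beat the hypercontractivity constant `81 ^ i`. -/
def cutoff (i : ℕ) : ℕ := 2 ^ (32 * i)

theorem one_le_cutoff (i : ℕ) : 1 ≤ cutoff i := Nat.one_le_two_pow

theorem cutoff_rpow (i : ℕ) (s : ℝ) : (cutoff i : ℝ) ^ s = ((2 : ℝ) ^ (32 * s)) ^ i := by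
  rw [cutoff, Nat.cast_pow, Nat.cast_ofNat, ← Real.rpow_natCast, ← Real.rpow_natCast,
    ← Real.rpow_mul zero_le_two, ← Real.rpow_mul zero_le_two]
  push_cast
  ring_nf

/-- The renormalised quartic truncated at the `i`-th cutoff is bounded below by a multiple of
`2 ^ i`. -/
theorem exists_neg_le_truncQuartic (hL : L < 2 * Real.pi) :
    ∃ D : ℝ, 0 < D ∧ ∀ (N i : ℕ) (g : modes N → ℝ),
      -(D * 2 ^ i) ≤ truncQuartic L (cutoff i) g := by
  obtain ⟨B, hB, h⟩ := exists_truncConst_le hL0.out hL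
  have hLp := hL0.out
  refine ⟨3 / 2 * L ^ 2 * B ^ 2, by positivity, fun N i g => ?_⟩
  refine le_trans (neg_le_neg ?_) (le_truncQuartic L N (cutoff i) g)
  obtain ⟨h1, h2⟩ := h N (cutoff i) (one_le_cutoff i)
  rw [mul_assoc _ (B ^ 2)]
  gcongr
  calc truncConst L N (cutoff i) ^ 2 ≤ (B * (cutoff i : ℝ) ^ (1 / 64 : ℝ)) ^ 2 := by gcongr
    _ = B ^ 2 * (cutoff i : ℝ) ^ (1 / 32 : ℝ) := by
      rw [mul_pow, ← Real.rpow_natCast (_ ^ (1 / 64 : ℝ)), ← Real.rpow_mul (Nat.cast_nonneg _)]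
      norm_num
    _ = B ^ 2 * 2 ^ i := by
      rw [cutoff_rpow]
      norm_num

/-- Hypercontractivity makes the truncation error at the `i`-th cutoff small in a moment whose
order grows exponentially with `i`. -/
theorem exists_gaussE_diffPoly_pow_le (hL : L < 2 * Real.pi) :
    ∃ B : ℝ, 0 < B ∧ ∀ N i : ℕ, gaussE (modes N) (diffPoly L N (cutoff i) ^ 2 ^ (i + 1))
      ≤ (B * (1 / 2) ^ i) ^ 2 ^ i := by
  obtain ⟨B, hB, h⟩ := exists_gaussE_diffPoly_sq_le (L := L) hL
  refine ⟨B, hB, fun N i => ?_⟩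
  refine (gaussE_pow_two_pow_le _ (totalDegree_diffPoly_le N (cutoff i)) i).trans ?_
  have h0 := gaussE_sq_nonneg (diffPoly L N (cutoff i))
  refine pow_le_pow_left₀ (by positivity) ?_ _
  calc (81 : ℝ) ^ i * gaussE (modes N) (diffPoly L N (cutoff i) ^ 2)
      ≤ 81 ^ i * (B * (cutoff i : ℝ) ^ (-(1 / 4) : ℝ)) := by
        gcongr
        exact h N _ (one_le_cutoff i)
    _ = B * (81 / 256) ^ i := by
        rw [cutoff_rpow, show (32 * -(1 / 4) : ℝ) = -(8 : ℕ) by norm_num,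
          Real.rpow_neg zero_le_two, Real.rpow_natCast, div_eq_mul_inv (81 : ℝ), mul_pow]
        norm_num
        ring
    _ ≤ B * (1 / 2) ^ i :=
        mul_le_mul_of_nonneg_left (pow_le_pow_left₀ (by norm_num) (by norm_num) i) hB.le

/-- Choose the first cutoff at which the truncation error is at least `-1`: the error at the
cutoff before it is then less than `-1`, so that its even powers are at least `1`. -/
theorem exp_neg_truncQuartic_le {D : ℝ} (hD : ∀ (N i : ℕ) (g : modes N → ℝ),
      -(D * 2 ^ i) ≤ truncQuartic L (cutoff i) g) (N : ℕ) (g : modes N → ℝ) :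
    Real.exp (-truncQuartic L N g) ≤ Real.exp (1 + D)
      + ∑ i ∈ Finset.range N, Real.exp (1 + D * 2 ^ (i + 1))
        * MvPolynomial.eval g (diffPoly L N (cutoff i) ^ 2 ^ (i + 1)) := by
  classical
  simp only [map_pow, eval_diffPoly]
  have heven : ∀ (i : ℕ) (t : ℝ), 0 ≤ t ^ 2 ^ (i + 1) := fun i t =>
    (even_two.pow_of_ne_zero (Nat.succ_ne_zero i)).pow_nonneg t
  have hN : -1 ≤ truncQuartic L N g - truncQuartic L (cutoff N) g := by
    have : N ≤ cutoff N := (Nat.lt_two_pow_self.le).trans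
      (Nat.pow_le_pow_right (by norm_num) (by omega))
    rw [truncQuartic_of_le this]
    linarith
  have hex : ∃ i, -1 ≤ truncQuartic L N g - truncQuartic L (cutoff i) g := ⟨N, hN⟩
  have hspec := Nat.find_spec hex
  have hmin := fun m => Nat.find_min hex (m := m)
  have hle := Nat.find_min' hex hN
  generalize Nat.find hex = i at *
  have hw : Real.exp (-truncQuartic L N g) ≤ Real.exp (1 + D * 2 ^ i) :=
    Real.exp_le_exp.2 (by linarith [hD N i g])
  have hterm : ∀ j ∈ Finset.range N, 0 ≤ Real.exp (1 + D * 2 ^ (j + 1))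
      * (truncQuartic L N g - truncQuartic L (cutoff j) g) ^ 2 ^ (j + 1) := fun j _ =>
    mul_nonneg (Real.exp_pos _).le (heven j _)
  cases i with
  | zero =>
    rw [pow_zero, mul_one] at hw
    exact hw.trans (le_add_of_nonneg_right (Finset.sum_nonneg hterm))
  | succ j =>
    have hj := hmin j (Nat.lt_succ_self j)
    push Not at hj
    have h1 : 1 ≤ (truncQuartic L N g - truncQuartic L (cutoff j) g) ^ 2 ^ (j + 1) := by
      rw [pow_succ', pow_mul]
      exact one_le_pow₀ (by nlinarith)
    calc _ ≤ Real.exp (1 + D * 2 ^ (j + 1)) := hw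
      _ ≤ Real.exp (1 + D * 2 ^ (j + 1))
          * (truncQuartic L N g - truncQuartic L (cutoff j) g) ^ 2 ^ (j + 1) :=
        le_mul_of_one_le_right (Real.exp_pos _).le h1
      _ ≤ _ := Finset.single_le_sum hterm (Finset.mem_range.2 hle)
      _ ≤ _ := le_add_of_nonneg_left (Real.exp_pos _).le

theorem summable_pow_two_pow (ρ : ℝ) (hρ : 0 ≤ ρ) :
    Summable fun i : ℕ => (ρ * (1 / 2) ^ i) ^ 2 ^ i := by
  have h1 : Filter.Tendsto (fun i : ℕ => ρ * (1 / 2 : ℝ) ^ i) Filter.atTop (nhds (ρ * 0)) :=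
    (tendsto_pow_atTop_nhds_zero_of_lt_one (by norm_num) (by norm_num)).const_mul ρ
  rw [mul_zero] at h1
  refine Summable.of_norm_bounded_eventually_nat summable_geometric_two ?_
  filter_upwards [h1.eventually_le_const (show (0 : ℝ) < 1 / 2 by norm_num)] with i hi
  have h0 : 0 ≤ ρ * (1 / 2 : ℝ) ^ i := by positivity
  rw [Real.norm_of_nonneg (pow_nonneg h0 _)]
  exact (pow_le_pow_left₀ h0 hi _).trans
    (pow_le_pow_of_le_one (by norm_num) (by norm_num) Nat.lt_two_pow_self.le)

/-- **Nelson's estimate**: `e^{-w_N}` is integrable with an integral bounded uniformly in `N`. -/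
theorem exists_integral_exp_neg_wickQuartic_le (hL : L < 2 * Real.pi) :
    ∃ K : ℝ, ∀ N : ℕ,
      Integrable (fun y : coeffSpace N => Real.exp (-wickQuartic L y)) (gaussianField L N) ∧
      ∫ y : coeffSpace N, Real.exp (-wickQuartic L y) ∂(gaussianField L N) ≤ K := by
  obtain ⟨D, -, hD⟩ := exists_neg_le_truncQuartic hL
  obtain ⟨B, hB, hP⟩ := exists_gaussE_diffPoly_pow_le hL
  have hsum := (summable_pow_two_pow (Real.exp (2 * D) * B) (by positivity)).mul_left (Real.exp 1)
  refine ⟨Real.exp (1 + D) + ∑' i : ℕ, Real.exp 1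
    * (Real.exp (2 * D) * B * (1 / 2) ^ i) ^ 2 ^ i, fun N => ?_⟩
  have := isProbabilityMeasure_gaussianField hL0.out hL N
  let bound : coeffSpace N → ℝ := fun y => Real.exp (1 + D)
    + ∑ i ∈ Finset.range N, Real.exp (1 + D * 2 ^ (i + 1))
      * MvPolynomial.eval (coordEquiv hL0.out hL N y) (diffPoly L N (cutoff i) ^ 2 ^ (i + 1))
  have hle : ∀ y : coeffSpace N, Real.exp (-wickQuartic L y) ≤ bound y := fun y => by
    rw [← truncQuartic_coordEquiv hL]
    exact exp_neg_truncQuartic_le hD N _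
  have hpoly := fun i => integral_eval_gaussianField hL0.out hL (N := N)
    (diffPoly L N (cutoff i) ^ 2 ^ (i + 1))
  have hsumint : ∀ i ∈ Finset.range N, Integrable (fun y => Real.exp (1 + D * 2 ^ (i + 1))
      * MvPolynomial.eval (coordEquiv hL0.out hL N y) (diffPoly L N (cutoff i) ^ 2 ^ (i + 1)))
      (gaussianField L N) := fun i _ => (hpoly i).1.const_mul _
  have hbound : Integrable bound (gaussianField L N) :=
    (integrable_const _).add (integrable_finsetSum _ hsumint)
  have hint : Integrable (fun y => Real.exp (-wickQuartic L y)) (gaussianField L N) := by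
    refine hbound.mono' (Continuous.aestronglyMeasurable ?_)
      (Filter.Eventually.of_forall fun y => ?_)
    · obtain ⟨p, hp⟩ := exists_eval_eq_truncQuartic (L := L) N N
      have hcont : Continuous (coordEquiv hL0.out hL N) :=
        (coordEquiv hL0.out hL N).toLinearMap.continuous_of_finiteDimensional
      simp only [← truncQuartic_coordEquiv hL, hp]
      have := p.continuous_eval.comp hcont
      exact Real.continuous_exp.comp this.neg
    · rw [Real.norm_of_nonneg (Real.exp_pos _).le]
      exact hle y
  refine ⟨hint, (integral_mono hint hbound hle).trans ?_⟩
  rw [integral_add (integrable_const _) (integrable_finsetSum _ hsumint),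
    integral_finsetSum _ hsumint, integral_const, probReal_univ, one_smul]
  gcongr
  refine (Finset.sum_le_sum fun i _ => ?_).trans
    (hsum.sum_le_tsum (Finset.range N) fun i _ => by positivity)
  rw [integral_const_mul, (hpoly i).2, mul_assoc, mul_pow (Real.exp (2 * D)),
    ← Real.exp_nat_mul, ← mul_assoc, ← Real.exp_add]
  push_cast
  rw [show (2 : ℝ) ^ i * (2 * D) = D * 2 ^ (i + 1) by ring]
  gcongr
  exact hP N i

end Nelson

end WickGalerkin

end

theorem proposition4p1 (L : ℝ) [Fact (0 < L)] (hL : L < 2 * Real.pi) :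
    ∃ K : ℝ, ∀ N : ℕ,
      Integrable (fun y : WickGalerkin.coeffSpace N => Real.exp (-WickGalerkin.wickQuartic L y))
        (WickGalerkin.gaussianField L N) ∧
      ∫ y : WickGalerkin.coeffSpace N, Real.exp (-WickGalerkin.wickQuartic L y)
        ∂(WickGalerkin.gaussianField L N) ≤ K :=
  WickGalerkin.exists_integral_exp_neg_wickQuartic_le hL
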